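/- Let $N\ge n\ge 1$, $m\ge 1$ and $q\ge 1$ be integers. Let $\{H_j\}_{j=1}^q$ be hyperplanes in $\mathbb{P}^n$ in general position and $\{H'_j\}_{j=1}^q$ hyperplanes in $\mathbb{P}^N$ in general position, where $\mathbb{P}^n$ denotes complex projective space and a family of hyperplanes in $\mathbb{P}^n$ is in general position if any $k\le n+1$ of its members (with distinct indices) are defined by linearly independent linear forms. Let $f:\mathbb{C}^m\to\mathbb{P}^n$ and $g:\mathbb{C}^m\to\mathbb{P}^N$ be meromorphic maps such that, for every $1\le j\le q$, \[ f(\mathbb{C}^m)\not\subseteq H_j,\qquad g(\mathbb{C}^m)\not\subseteq H'_j,\qquad f^*(H_j)=g^*(H'_j). \] Here, for a hyperplane $H=\{a_0x_0+\dots+a_nx_n=0\}$, the pullback divisor $f^*(H)$ is the zero divisor of the holomorphic function $a_0f_0+\dots+a_nf_n$, where $(f_0,\dots,f_n)$ is a reduced representation of $f$, that is, $f_0,\dots,f_n$ are holomorphic, their common zero set is the indeterminacy locus $I(f)$, which has codimension at least $2$, and $f=[f_0:\dots:f_n]$ outside $I(f)$. Suppose that $g(\mathbb{C}^m)$ is not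 contained in any hypersurface of degree $\le\min\{n+1,\,N-n+2\}$ in $\mathbb{P}^N$ and that \[ q\ \ge\ \max\Big\{3n+1,\ \min\big\{2N+1,\ N+\tfrac32 n+\tfrac32\big\}\Big\}. \] Then $N=n$, and there is a projective linear transformation $L$ of $\mathbb{P}^n$ such that $f=L(g)$ and such that either \[ L(H'_{k_i})=H_{k_i},\quad 1\le i\le n+2, \] for some $n+2$ distinct indices $k_1,\dots,k_{n+2}\in\{1,\dots,q\}$, or \[ L(H'_{k_i})=H_{k_i},\quad 1\le i\le n+1,\qquad L(H'_{k_{n+2}})=H_{k_{n+3}},\qquad L(H'_{k_{n+3}})=H_{k_{n+2}}, \] for some $n+3$ distinct indices $k_1,\dots,k_{n+3}\in\{1,\dots,q\}$. -/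

import Mathlib

open scoped LinearAlgebra.Projectivization

/-- Complex projective space `ℙⁿ`: lines through the origin in `ℂⁿ⁺¹`. -/
abbrev ProjSpace (n : ℕ) : Type := ℙ ℂ (Fin (n + 1) → ℂ)

/-- An analytic subset `A` of `ℂᵐ` has codimension at least `k`: for every point `a` of `A` there is
a `k`-dimensional complex affine subspace `a + E` in which `a` is an isolated point
of `A ∩ (a + E)`. -/
def CodimAtLeast {m : ℕ} (k : ℕ) (A : Set (Fin m → ℂ)) : Prop :=
  ∀ a ∈ A, ∃ E : Submodule ℂ (Fin m → ℂ), Module.finrank ℂ E = k ∧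
    ∀ᶠ w in nhds a, w ∈ A → w - a ∈ E → w = a

/-- The tuple `φ = (φ₀, …, φₙ)` of holomorphic functions on the set `U` is a reduced representation
on `U` of the map `F` defined off the set `I`: the common zeros of `φ₀, …, φₙ` in `U` are exactly
the points of `I`, and `F = [φ₀ : … : φₙ]` on `U \ I`. -/
structure IsReducedRep {m n : ℕ} (I : Set (Fin m → ℂ)) (F : (Iᶜ : Set (Fin m → ℂ)) → ProjSpace n)
    (U : Set (Fin m → ℂ)) (φ : (Fin m → ℂ) → (Fin (n + 1) → ℂ)) : Prop where
  holomorphic : AnalyticOnNhd ℂ φ U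
  zero_iff : ∀ z ∈ U, φ z = 0 ↔ z ∈ I
  eq_mk : ∀ z ∈ U, ∀ (hz : z ∈ Iᶜ) (h0 : φ z ≠ 0), F ⟨z, hz⟩ = Projectivization.mk ℂ (φ z) h0

/-- A meromorphic map of `ℂᵐ` into `ℙⁿ`: a map into `ℙⁿ` defined off an indeterminacy locus of
codimension at least two, which has a reduced representation near every point of `ℂᵐ`
(in particular the indeterminacy locus is an analytic subset). -/
structure MeromorphicMap (m n : ℕ) where
  indet : Set (Fin m → ℂ)
  toFun : (indetᶜ : Set (Fin m → ℂ)) → ProjSpace n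
  codim_indet : CodimAtLeast 2 indet
  exists_rep : ∀ z : Fin m → ℂ, ∃ U : Set (Fin m → ℂ), IsOpen U ∧ z ∈ U ∧
    ∃ φ : (Fin m → ℂ) → (Fin (n + 1) → ℂ), IsReducedRep indet toFun U φ

/-- A hyperplane of `ℙⁿ`, given by a nonzero linear form up to scalars. -/
abbrev Hyperplane (n : ℕ) : Type := ℙ ℂ (Module.Dual ℂ (Fin (n + 1) → ℂ))

/-- The set of points of a hyperplane. -/
def Hyperplane.carrier {n : ℕ} (H : Hyperplane n) : Set (ProjSpace n) :=
  {x | H.rep x.rep = 0}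

/-- General position: any at most `n + 1` members (with distinct indices) of the family are defined
by linearly independent linear forms. -/
def InGeneralPosition {n q : ℕ} (H : Fin q → Hyperplane n) : Prop :=
  ∀ s : Finset (Fin q), s.card ≤ n + 1 → Projectivization.Independent (fun i : s => H i)

/-- The set of zeros in `ℙⁿ` of a homogeneous polynomial. -/
def projZeros {n : ℕ} (P : MvPolynomial (Fin (n + 1)) ℂ) : Set (ProjSpace n) :=
  {x | MvPolynomial.eval x.rep P = 0}

/-- `X` is a hypersurface of degree `d` in `ℙⁿ`. -/
def IsHypersurface {n : ℕ} (d : ℕ) (X : Set (ProjSpace n)) : Prop :=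
  1 ≤ d ∧ ∃ P : MvPolynomial (Fin (n + 1)) ℂ, P ≠ 0 ∧ P.IsHomogeneous d ∧ X = projZeros P

/-- The holomorphic functions `F` and `G` have the same zero divisor at `z`: their germs at `z` are
local equations of the same effective (Cartier) divisor, that is, they differ by
a holomorphic factor that does not vanish at `z`. -/
def SameZeroDivisorAt {m : ℕ} (F G : (Fin m → ℂ) → ℂ) (z : Fin m → ℂ) : Prop :=
  ∃ u : (Fin m → ℂ) → ℂ, AnalyticAt ℂ u z ∧ u z ≠ 0 ∧ ∀ᶠ w in nhds z, F w = u w * G w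

namespace MeromorphicMap

variable {m n N : ℕ}

/-- The image of a meromorphic map: the values at the points where the map is defined. -/
def image (f : MeromorphicMap m n) : Set (ProjSpace n) := Set.range f.toFun

/-- `φ` is a reduced representation of `f` on some neighbourhood of `z`. -/
def IsRepAt (f : MeromorphicMap m n) (z : Fin m → ℂ)
    (φ : (Fin m → ℂ) → (Fin (n + 1) → ℂ)) : Prop :=
  ∃ U : Set (Fin m → ℂ), IsOpen U ∧ z ∈ U ∧ IsReducedRep f.indet f.toFun U φ

/-- Equality `f^*(H) = g^*(H')` of pullback divisors: near each point, `f^*(H)` is the zero divisor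
of the function `(f, H) = a₀ φ₀ + … + aₙ φₙ`, where `φ` is a reduced representation of `f`
and `a₀ X₀ + … + aₙ Xₙ` is a linear form defining `H`, and likewise for `g^*(H')`. -/
def SamePullbackDivisor (f : MeromorphicMap m n) (H : Hyperplane n)
    (g : MeromorphicMap m N) (H' : Hyperplane N) : Prop :=
  ∀ (z : Fin m → ℂ) (φ : (Fin m → ℂ) → (Fin (n + 1) → ℂ)) (ψ : (Fin m → ℂ) → (Fin (N + 1) → ℂ)),
    f.IsRepAt z φ → g.IsRepAt z ψ →
      SameZeroDivisorAt (fun w => H.rep (φ w)) (fun w => H'.rep (ψ w)) z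

end MeromorphicMap

/-- The projective linear isomorphism induced by a linear isomorphism. -/
noncomputable def projLinear {N n : ℕ} (L : (Fin (N + 1) → ℂ) ≃ₗ[ℂ] (Fin (n + 1) → ℂ)) :
    ProjSpace N → ProjSpace n :=
  Projectivization.map L.toLinearMap L.injective

/-- The composition `L(g)` of a meromorphic map `g` with the projective linear isomorphism
induced by `L`. -/
noncomputable def MeromorphicMap.linearImage {m N n : ℕ} (L : (Fin (N + 1) → ℂ) ≃ₗ[ℂ] (Fin (n + 1) → ℂ))
    (g : MeromorphicMap m N) : MeromorphicMap m n where
  indet := g.indet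
  toFun := fun z => projLinear L (g.toFun z)
  codim_indet := g.codim_indet
  exists_rep := by
    intro z
    obtain ⟨U, hU, hz, φ, hφ⟩ := g.exists_rep z
    refine ⟨U, hU, hz, fun w => L (φ w), ?_, ?_, ?_⟩
    · intro w hw
      exact ((LinearMap.toContinuousLinearMap L.toLinearMap).analyticAt (φ w)).comp
        (hφ.holomorphic w hw)
    · intro w hw
      rw [← hφ.zero_iff w hw]
      simp
    · intro w hw hwI h0
      have h1 : φ w ≠ 0 := fun h => h0 (by simp [h])
      rw [hφ.eq_mk w hw hwI h1]
      rfl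

/-! ### Growth lemma of Borel type -/

section Growth

/-! Equality of pullback divisors makes the quotients `(f, H j) / (g, H' j)` nowhere vanishing.
After division by one of them they become globally defined entire units `R j` on `ℂᵐ`
(`exists_ratioFamily`). For any `n + N + 2` indices, the vector formed from representations of `f`
and `g` lies in the kernel of the matrix with rows `(H j, R j • H' j)`, so its determinant is zero.
Expanding it by rows gives a vanishing sum of products of `N + 1` units, and by general position the
coefficients of exactly these products are nonzero (`det_piecewise_ne_zero_iff`). Borel's theorem
makes each product proportional to another one (`IsRatioFamily.exists_exchange`).

Modulo constants the units generate a finitely generated torsion-free abelian group, which embeds in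
a lexicographically ordered `ℤ^ρ`. The resulting weights have Fujimoto's exchange property. Sorting
them and comparing extreme sums (`ExchangeProperty.heavy_or_two`) leaves two cases. If two classes
of equal weight have `n + 3` members together and `n + 2 ≤ N`, elimination gives a nontrivial
quadric containing the image of `g`, which is excluded (`IsRatioFamily.not_two_classes`). Otherwise
`n + 1` weights agree, so `f = M(g)` with `M` linear, and there is one more relation among the
remaining weights. It is an identity of degree at most `min (n + 1) (N - n + 2)` along `g`, hence an
identity of polynomials. Comparing linear factors matches a further hyperplane, forces `N = n`, and
gives the two alternatives (`IsRatioFamily.exists_matching`).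

Borel's theorem reduces to linearly independent units `v j = exp (p j)` with sum `1`. Cramer's rule
applied to a determinant of the quotients of derivatives by `v j`, together with Jensen's and
Schwarz's formulas, bounds the derivatives of the `p j` on a disc by the logarithm of their bound on
a slightly larger disc. The growth lemma then makes these derivatives zero. -/

theorem growth_step {A : ℝ → ℝ} {K L : ℝ} (hK : 0 < K) (hL : 0 < L)
    (hA : ∀ r h : ℝ, 0 < r → 0 < h →
      A r ≤ K * (r + h) / h ^ 2 * (1 + Real.log (1 + A (r + 2 * h) + L / h))) (hA0 : ∀ r, 0 ≤ A r) :
    ∃ x₀ : ℝ, 1 ≤ x₀ ∧ ∀ x r : ℝ, x₀ ≤ x → 0 < r → r ≤ x → x ^ 8 ≤ A r →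
      (2 * x) ^ 8 ≤ A (r + 1 / x) := by
  -- The step is `h = 1 / (2 * x)`. If `A r ≥ x ^ 8` but `A (r + 1 / x) < (2 * x) ^ 8`, the
  -- hypothesis gives `x ^ 8 ≤ const * x ^ 4`, which is false for large `x`. Here `257 = 1 + 2 ^ 8`
  -- collects the terms inside the logarithm.
  set C := Real.log (257 + 2 * L) with hC
  have hC0 : 0 ≤ C := Real.log_nonneg (by linarith)
  refine ⟨1 + 8 * K * (9 + C), by nlinarith, fun x r hx hr hrx hxA => ?_⟩
  have hx1 : 1 ≤ x := by nlinarith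
  have hxp : 0 < x := by linarith
  by_contra! hcon
  have h1 := hA r (1 / (2 * x)) hr (by positivity)
  have e1 : r + 2 * (1 / (2 * x)) = r + 1 / x := by field_simp
  have e2 : L / (1 / (2 * x)) = 2 * L * x := by field_simp
  rw [e1, e2] at h1
  have hlog : Real.log (1 + A (r + 1 / x) + 2 * L * x) ≤ C + 8 * x := by
    have hx8 : x ≤ x ^ 8 := le_self_pow₀ hx1 (by norm_num)
    have hx81 : 1 ≤ x ^ 8 := one_le_pow₀ hx1
    have : 1 + A (r + 1 / x) + 2 * L * x ≤ (257 + 2 * L) * x ^ 8 := by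
      have : (2 * x) ^ 8 = 256 * x ^ 8 := by ring
      nlinarith
    have hpos : 0 < 1 + A (r + 1 / x) + 2 * L * x := by
      have := hA0 (r + 1 / x)
      positivity
    calc _ ≤ Real.log ((257 + 2 * L) * x ^ 8) := Real.log_le_log hpos this
      _ = C + 8 * Real.log x := by
        rw [Real.log_mul (by positivity) (by positivity), Real.log_pow]; norm_num [hC]
      _ ≤ C + 8 * x := by
        have := Real.log_le_sub_one_of_pos hxp
        linarith
  have hcoef : K * (r + 1 / (2 * x)) / (1 / (2 * x)) ^ 2 ≤ 8 * K * x ^ 3 := by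
    have : 1 / (2 * x) ≤ x := by
      rw [div_le_iff₀ (by positivity)]; nlinarith
    have e3 : K * (r + 1 / (2 * x)) / (1 / (2 * x)) ^ 2 = K * (r + 1 / (2 * x)) * (4 * x ^ 2) := by
      field_simp; ring
    rw [e3]
    calc K * (r + 1 / (2 * x)) * (4 * x ^ 2) ≤ K * (x + x) * (4 * x ^ 2) := by gcongr
      _ = 8 * K * x ^ 3 := by ring
  have hcoef0 : 0 ≤ K * (r + 1 / (2 * x)) / (1 / (2 * x)) ^ 2 := by positivity
  have h2 : x ^ 8 ≤ 8 * K * x ^ 3 * (1 + (C + 8 * x)) := by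
    refine hxA.trans (h1.trans ?_)
    refine (mul_le_mul_of_nonneg_left (add_le_add_right hlog 1) hcoef0).trans ?_
    exact mul_le_mul_of_nonneg_right hcoef (by positivity)
  have h3 : 8 * K * x ^ 3 * (1 + (C + 8 * x)) ≤ 8 * K * (9 + C) * x ^ 4 := by
    have : 1 + (C + 8 * x) ≤ (9 + C) * x := by nlinarith
    calc _ ≤ 8 * K * x ^ 3 * ((9 + C) * x) := by gcongr
      _ = _ := by ring
  have h4 : 8 * K * (9 + C) * x ^ 4 < x ^ 5 := by
    have : 8 * K * (9 + C) < x := by linarith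
    calc _ < x * x ^ 4 := by gcongr
      _ = x ^ 5 := by ring
  have h5 : x ^ 5 ≤ x ^ 8 := pow_le_pow_right₀ hx1 (by norm_num)
  linarith

/-- A growth lemma of Borel type: a monotone function that is controlled by the logarithm of its
values at slightly larger arguments vanishes identically. -/
theorem eq_zero_of_log_growth {A : ℝ → ℝ} {K L : ℝ} (hK : 0 < K) (hL : 0 < L)
    (hmono : ∀ r s, 0 < r → r ≤ s → A r ≤ A s) (hA0 : ∀ r, 0 ≤ A r)
    (hA : ∀ r h : ℝ, 0 < r → 0 < h →
      A r ≤ K * (r + h) / h ^ 2 * (1 + Real.log (1 + A (r + 2 * h) + L / h)))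
    {r : ℝ} (hr : 0 < r) : A r = 0 := by
  obtain ⟨x₀, hx₀, hstep⟩ := growth_step hK hL hA hA0
  have hpoly : ∀ r, x₀ ≤ r → A r < (r + 2) ^ 8 := by
    intro r₀ hr₀
    by_contra! hcon
    set x : ℕ → ℝ := fun n => 2 ^ n * (r₀ + 2) with hx
    -- Each doubling of `x n` costs a radius increment `1 / x n`. The increments form a geometric
    -- series that stays below `2`, so `A (r₀ + 2)` would exceed every power of `2`.
    have key : ∀ n : ℕ, ∃ s, r₀ ≤ s ∧ s ≤ r₀ + 2 - 2 / x n ∧ x n ^ 8 ≤ A s := by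
      intro n
      induction n with
      | zero =>
        refine ⟨r₀, le_rfl, ?_, by simpa [hx] using hcon⟩
        have : 2 / x 0 ≤ 2 := by
          rw [div_le_iff₀ (by simp [hx]; linarith)]; simp [hx]; linarith
        linarith
      | succ n ih =>
        obtain ⟨s, hs1, hs2, hs3⟩ := ih
        have hxn : r₀ + 2 ≤ x n := by
          have : (1 : ℝ) ≤ 2 ^ n := one_le_pow₀ (by norm_num)
          simp only [hx]; nlinarith
        have hxn0 : 0 < x n := by linarith
        have hxs : x (n + 1) = 2 * x n := by simp only [hx]; ring
        refine ⟨s + 1 / x n, by have : 0 < 1 / x n := by positivity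
                                linarith, ?_, ?_⟩
        · rw [hxs]
          have : 2 / (2 * x n) = 1 / x n := by field_simp
          rw [this]
          have : 2 / x n = 1 / x n + 1 / x n := by field_simp; norm_num
          linarith
        · rw [hxs]
          apply hstep (x n) s (by linarith) (by linarith) ?_ hs3
          have : 0 < 2 / x n := by positivity
          linarith
    obtain ⟨n, hn⟩ := pow_unbounded_of_one_lt (A (r₀ + 2)) (one_lt_two : (1 : ℝ) < 2)
    obtain ⟨s, hs1, hs2, hs3⟩ := key n
    have h1 : (2 : ℝ) ^ n ≤ x n := by
      have : (0 : ℝ) < 2 ^ n := by positivity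
      simp only [hx]; nlinarith
    have h11 : (1 : ℝ) ≤ 2 ^ n := one_le_pow₀ (by norm_num)
    have h2 : x n ≤ x n ^ 8 := le_self_pow₀ (by linarith) (by norm_num)
    have h3 : A s ≤ A (r₀ + 2) := hmono s _ (by linarith) (by
      have : 0 < 2 / x n := by apply div_pos <;> linarith
      linarith)
    linarith
  -- With polynomial growth known, take radius and step both `ρ / 3`: the coefficient is `6 * K / ρ`
  -- and the logarithm is `O(√ρ)`, so the bound tends to `0`.
  have hbound : ∀ ρ : ℝ, x₀ + 3 * r + 2 + L ≤ ρ → A r ≤ 6 * K * 41 * (1 / Real.sqrt ρ) := by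
    intro ρ hρ
    have hρ0 : 0 < ρ := by linarith
    have hρ1 : 3 ≤ ρ := by linarith
    have h1 := hA (ρ / 3) (ρ / 3) (by linarith) (by linarith)
    have e1 : ρ / 3 + 2 * (ρ / 3) = ρ := by ring
    rw [e1] at h1
    have h2 : 1 + A ρ + L / (ρ / 3) ≤ ρ ^ 20 := by
      have a1 := hpoly ρ (by linarith)
      have a2 : L / (ρ / 3) ≤ 3 := by rw [div_le_iff₀ (by linarith)]; linarith
      have a3 : (ρ + 2) ^ 8 ≤ (ρ ^ 2) ^ 8 := by
        apply pow_le_pow_left₀ (by linarith); nlinarith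
      have a4 : (ρ ^ 2) ^ 8 * 81 ≤ ρ ^ 20 := by
        calc (ρ ^ 2) ^ 8 * 81 = ρ ^ 16 * 3 ^ 4 := by ring
          _ ≤ ρ ^ 16 * ρ ^ 4 := by gcongr
          _ = _ := by ring
      have a5 : 1 ≤ (ρ ^ 2) ^ 8 := one_le_pow₀ (by nlinarith)
      linarith
    have h3 : Real.log (1 + A ρ + L / (ρ / 3)) ≤ 40 * Real.sqrt ρ := by
      have hp : 0 < 1 + A ρ + L / (ρ / 3) := by
        have := hA0 ρ
        positivity
      have hs : 0 < Real.sqrt ρ := Real.sqrt_pos.2 hρ0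
      calc _ ≤ Real.log (ρ ^ 20) := Real.log_le_log hp h2
        _ = 20 * Real.log ρ := by rw [Real.log_pow]; norm_num
        _ = 40 * Real.log (Real.sqrt ρ) := by
          rw [Real.log_sqrt hρ0.le]; ring
        _ ≤ _ := by
          have := Real.log_le_sub_one_of_pos hs
          linarith
    have hs1 : 1 ≤ Real.sqrt ρ := Real.one_le_sqrt.2 (by linarith)
    have h4 : K * (ρ / 3 + ρ / 3) / (ρ / 3) ^ 2 = 6 * K / ρ := by field_simp; ring
    rw [h4] at h1
    have h5 : A r ≤ A (ρ / 3) := hmono r _ hr (by linarith)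
    have h6 : 6 * K / ρ * (1 + Real.log (1 + A ρ + L / (ρ / 3))) ≤ 6 * K / ρ * (41 * Real.sqrt ρ) := by
      gcongr; linarith
    have h7 : 6 * K / ρ * (41 * Real.sqrt ρ) = 6 * K * 41 * (1 / Real.sqrt ρ) := by
      have : ρ = Real.sqrt ρ * Real.sqrt ρ := (Real.mul_self_sqrt hρ0.le).symm
      have hs0 : Real.sqrt ρ ≠ 0 := by positivity
      nth_rewrite 1 [this]
      field_simp
    linarith
  apply le_antisymm _ (hA0 r)
  have ht : Filter.Tendsto (fun ρ : ℝ => 6 * K * 41 * (1 / Real.sqrt ρ)) Filter.atTop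
      (nhds (6 * K * 41 * 0)) := by
    apply Filter.Tendsto.const_mul
    simp only [one_div]
    exact Filter.Tendsto.inv_tendsto_atTop Real.tendsto_sqrt_atTop
  rw [mul_zero] at ht
  apply ge_of_tendsto ht
  filter_upwards [Filter.eventually_ge_atTop (x₀ + 3 * r + 2 + L)] with ρ hρ using hbound ρ hρ

end Growth

/-! ### Schwarz formula for the derivative of an entire function -/

section Schwarz
open Metric Real

theorem circleAverage_conj (f : ℂ → ℂ) (c : ℂ) (R : ℝ) :
    circleAverage (fun z => (starRingEnd ℂ) (f z)) c R = (starRingEnd ℂ) (circleAverage f c R) := by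
  simp only [circleAverage, Complex.real_smul, map_mul, Complex.conj_ofReal]
  congr 1
  simp only [intervalIntegral.intervalIntegral_eq_integral_uIoc, Complex.real_smul, map_mul,
    Complex.conj_ofReal, integral_conj]

/-- Cauchy's formula computes `deriv p z` from `p`, while the same kernel applied to the conjugate
of `p` averages to zero. Adding the two replaces `p` by twice its real part. -/
theorem deriv_eq_circleAverage_re {p : ℂ → ℂ} (hp : Differentiable ℂ p) {z : ℂ} {R : ℝ}
    (hz : ‖z‖ < R) :
    deriv p z = circleAverage (fun ζ => 2 * (ζ / (ζ - z) ^ 2) * ((p ζ).re : ℂ)) 0 R := by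
  have hR : 0 < R := (norm_nonneg z).trans_lt hz
  have hne : ∀ ζ ∈ sphere (0 : ℂ) |R|, ζ - z ≠ 0 := by
    intro ζ hζ h
    rw [abs_of_pos hR, mem_sphere_zero_iff_norm] at hζ
    rw [sub_eq_zero.1 h] at hζ
    linarith
  have hcont : ContinuousOn (fun ζ : ℂ => ζ / (ζ - z) ^ 2) (sphere 0 |R|) := by
    apply ContinuousOn.div (by fun_prop) (by fun_prop)
    intro ζ hζ
    exact pow_ne_zero 2 (hne ζ hζ)
  have h1 : circleAverage (fun ζ => ζ / (ζ - z) ^ 2 * p ζ) 0 R = deriv p z := by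
    rw [circleAverage_eq_circleIntegral hR.ne']
    have := Complex.two_pi_I_inv_smul_circleIntegral_sub_sq_inv_smul_of_differentiable
      (U := Set.univ) (c := 0) (R := R) (w₀ := z) (f := p) isOpen_univ (by simp)
      hp.differentiableOn (by simpa using hz)
    rw [← this]
    congr 1
    apply circleIntegral.integral_congr hR.le
    intro ζ hζ
    have : ζ ≠ 0 := by
      rintro rfl
      simp at hζ; linarith
    simp only [sub_zero, smul_eq_mul]
    field_simp
  have h2 : circleAverage (fun ζ => ζ / (ζ - z) ^ 2 * (starRingEnd ℂ) (p ζ)) 0 R = 0 := by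
    -- On the circle the conjugate of `ζ` is `R ^ 2 / ζ`, so the conjugate of the integrand agrees
    -- there with `g`, which is holomorphic on the closed disc and vanishes at `0`.
    set g : ℂ → ℂ := fun ζ => R ^ 2 * ζ / (R ^ 2 - (starRingEnd ℂ) z * ζ) ^ 2 * p ζ with hg
    have hden : ∀ ζ ∈ closedBall (0 : ℂ) |R|, (R : ℂ) ^ 2 - (starRingEnd ℂ) z * ζ ≠ 0 := by
      intro ζ hζ h
      rw [abs_of_pos hR, mem_closedBall_zero_iff] at hζ
      have := congrArg norm (sub_eq_zero.1 h)
      simp only [norm_pow, Complex.norm_real, norm_eq_abs, norm_mul, RCLike.norm_conj, sq_abs] at this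
      nlinarith [norm_nonneg ζ, norm_nonneg z]
    have hd : DifferentiableOn ℂ g (closedBall 0 |R|) := by
      intro ζ hζ
      apply DifferentiableAt.differentiableWithinAt
      apply DifferentiableAt.mul _ (hp ζ)
      apply DifferentiableAt.div (by fun_prop) (by fun_prop)
      exact pow_ne_zero 2 (hden ζ hζ)
    have h3 : circleAverage g 0 R = 0 := by
      rw [DiffContOnCl.circleAverage]
      · simp [hg]
      · exact DifferentiableOn.diffContOnCl_ball hd le_rfl
    trans (starRingEnd ℂ) (circleAverage g 0 R)
    swap
    · rw [h3, map_zero]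
    rw [← circleAverage_conj]
    apply circleAverage_congr_sphere
    intro ζ hζ
    have hζ' := hζ
    rw [abs_of_pos hR, mem_sphere_zero_iff_norm] at hζ'
    have hζ0 : ζ ≠ 0 := by rintro rfl; simp at hζ'; linarith
    have hconj : (starRingEnd ℂ) ζ = R ^ 2 / ζ := by
      rw [eq_div_iff hζ0, mul_comm, Complex.mul_conj, Complex.normSq_eq_norm_sq, hζ']; push_cast; rfl
    have hR0 : (R : ℂ) ≠ 0 := by exact_mod_cast hR.ne'
    have hz0 := hne ζ hζ
    simp only [hg, map_mul, map_div₀, map_pow, map_sub, Complex.conj_ofReal, Complex.conj_conj, hconj]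
    congr 1
    field_simp
  have i1 : CircleIntegrable (fun ζ => ζ / (ζ - z) ^ 2 * p ζ) 0 R :=
    ContinuousOn.circleIntegrable' (hcont.mul hp.continuous.continuousOn)
  have i2 : CircleIntegrable (fun ζ => ζ / (ζ - z) ^ 2 * (starRingEnd ℂ) (p ζ)) 0 R :=
    ContinuousOn.circleIntegrable' (hcont.mul (Complex.continuous_conj.comp hp.continuous).continuousOn)
  have h4 := circleAverage_fun_add i1 i2
  rw [h1, h2, add_zero] at h4
  rw [← h4]
  congr 1
  ext ζ
  rw [← mul_add, Complex.add_conj]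
  push_cast
  ring

theorem norm_circleAverage_le {f : ℂ → ℂ} {g : ℂ → ℝ} {c : ℂ} {R : ℝ}
    (hg : CircleIntegrable g c R) (h : ∀ z ∈ sphere c |R|, ‖f z‖ ≤ g z) :
    ‖circleAverage f c R‖ ≤ circleAverage g c R := by
  rw [circleAverage, circleAverage, norm_smul, Real.norm_of_nonneg (by positivity), smul_eq_mul]
  gcongr
  apply intervalIntegral.norm_integral_le_of_norm_le (by positivity) _ hg
  filter_upwards with θ _
  exact h _ (circleMap_mem_sphere' c R θ)

/-- The derivative of an entire function is bounded by circle averages of its real part. -/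
theorem norm_deriv_le_circleAverage_abs_re {p : ℂ → ℂ} (hp : Differentiable ℂ p) {z : ℂ} {R : ℝ}
    (hz : ‖z‖ < R) :
    ‖deriv p z‖ ≤ 2 * R / (R - ‖z‖) ^ 2 * circleAverage (fun ζ => |(p ζ).re|) 0 R := by
  have hR : 0 < R := (norm_nonneg z).trans_lt hz
  rw [deriv_eq_circleAverage_re hp hz, ← smul_eq_mul, ← circleAverage_fun_smul]
  have hc : Continuous fun ζ => |(p ζ).re| := (Complex.continuous_re.comp hp.continuous).abs
  apply norm_circleAverage_le
  · exact ContinuousOn.circleIntegrable' (Continuous.continuousOn (continuous_const.mul hc))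
  · intro ζ hζ
    rw [abs_of_pos hR, mem_sphere_zero_iff_norm] at hζ
    simp only [norm_mul, norm_div, norm_pow, Complex.norm_real, smul_eq_mul, norm_eq_abs, hζ,
      Complex.norm_ofNat]
    have h1 : R - ‖z‖ ≤ ‖ζ - z‖ := by rw [← hζ]; exact norm_sub_norm_le ζ z
    have h2 : 0 < R - ‖z‖ := by linarith
    rw [mul_div_assoc]
    gcongr

end Schwarz

/-! ### Logarithmic derivatives and determinants of derivatives -/

section Wronskian
open Metric

/-- The quotient `Q = v⁽ˡ⁾ / v` satisfies `v⁽ˡ⁺¹⁾ / v = Q' + Q * (v' / v)`. Cauchy's estimate on a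
disc of radius `δ` bounds `Q'` at the price of a factor `1 / δ` and a loss `δ` of radius. -/
theorem norm_iteratedDeriv_div_le {v : ℂ → ℂ} (hv : Differentiable ℂ v) (hv0 : ∀ z, v z ≠ 0)
    {δ A : ℝ} (hδ : 0 < δ) (l : ℕ) (r : ℝ)
    (hA : ∀ z, ‖z‖ ≤ r + l * δ → ‖deriv v z / v z‖ ≤ A) :
    ∀ z, ‖z‖ ≤ r → ‖iteratedDeriv l v z / v z‖ ≤ (A + 1 / δ) ^ l := by
  induction l generalizing r with
  | zero => intro z _; simp [hv0 z]
  | succ l ih =>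
    intro z hz
    have hd : ∀ k, Differentiable ℂ (iteratedDeriv k v) := fun k =>
      (hv.contDiff (n := ((k + 1 : ℕ) : WithTop ℕ∞))).differentiable_iteratedDeriv k
        (by exact_mod_cast Nat.lt_succ_self k)
    have hB : ∀ w, ‖w‖ ≤ r + δ → ‖iteratedDeriv l v w / v w‖ ≤ (A + 1 / δ) ^ l := by
      apply ih
      intro w hw
      apply hA
      push_cast
      linarith
    have hQ : Differentiable ℂ (fun w => iteratedDeriv l v w / v w) := (hd l).div hv hv0
    have h1 : iteratedDeriv (l + 1) v z / v z = deriv (fun w => iteratedDeriv l v w / v w) z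
        + iteratedDeriv l v z / v z * (deriv v z / v z) := by
      rw [deriv_fun_div (hd l z) (hv z) (hv0 z), iteratedDeriv_succ]
      have := hv0 z
      field_simp
      ring
    have h2 : ‖deriv (fun w => iteratedDeriv l v w / v w) z‖ ≤ (A + 1 / δ) ^ l / δ := by
      apply Complex.norm_deriv_le_of_forall_mem_sphere_norm_le hδ hQ.diffContOnCl
      intro w hw
      apply hB
      have := norm_le_norm_add_norm_sub' w z
      rw [mem_sphere, dist_eq_norm] at hw
      linarith
    have h3 : ‖deriv v z / v z‖ ≤ A := hA z (by push_cast; nlinarith [(Nat.cast_nonneg l : (0:ℝ) ≤ l)])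
    have h4 := hB z (by linarith)
    rw [h1]
    refine (norm_add_le _ _).trans ?_
    rw [norm_mul]
    calc _ ≤ (A + 1 / δ) ^ l / δ + (A + 1 / δ) ^ l * A :=
          add_le_add h2 (mul_le_mul h4 h3 (norm_nonneg _) ((norm_nonneg _).trans h4))
      _ = _ := by ring

/-- Entire functions that are linearly independent have a nonvanishing determinant of derivatives
(of suitable orders) at the origin. -/
theorem exists_det_iteratedDeriv_ne_zero {k : ℕ} {v : Fin k → ℂ → ℂ}
    (hv : ∀ j, Differentiable ℂ (v j)) (hli : LinearIndependent ℂ v) :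
    ∃ l : Fin k → ℕ, (Matrix.of fun i j => iteratedDeriv (l i) (v j) 0).det ≠ 0 := by
  set row : ℕ → Fin k → ℂ := fun l j => iteratedDeriv l (v j) 0 with hrow
  -- A functional that kills all rows is a linear combination of the `v j` with zero Taylor series
  -- at `0`, contrary to independence. Hence some `k` rows form a basis.
  have hspan : Submodule.span ℂ (Set.range row) = ⊤ := by
    by_contra hne
    obtain ⟨φ, hφ0, hφ⟩ := Submodule.exists_le_ker_of_lt_top _ (lt_top_iff_ne_top.2 hne)
    apply hφ0
    have hc : ∀ x, φ x = ∑ j, x j * φ (Pi.single j 1) := by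
      intro x
      conv_lhs => rw [pi_eq_sum_univ' x]
      simp [map_sum]
    set F : ℂ → ℂ := fun z => ∑ j, φ (Pi.single j 1) * v j z with hF
    have hFd : Differentiable ℂ F := by
      apply Differentiable.fun_sum
      intro j _
      exact (hv j).const_mul _
    have hF0 : F = 0 := by
      have hiter : ∀ l, iteratedDeriv l F 0 = 0 := by
        intro l
        have h1 : iteratedDeriv l F 0 = ∑ j, φ (Pi.single j 1) * iteratedDeriv l (v j) 0 := by
          rw [hF, iteratedDeriv_fun_sum]
          · apply Finset.sum_congr rfl
            intro j _
            rw [iteratedDeriv_const_mul_field]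
          · intro j _
            exact ((hv j).contDiff.const_smul (φ (Pi.single j 1))).contDiffAt
        have h2 : φ (row l) = 0 := hφ (Submodule.subset_span ⟨l, rfl⟩)
        rw [hc] at h2
        rw [h1]
        refine Eq.trans ?_ h2
        exact Finset.sum_congr rfl fun j _ => mul_comm _ _
      funext z
      have := Complex.taylorSeries_eq_of_entire' (c := 0) z hFd
      rw [← this]
      simp [hiter]
    have hzero : ∀ j, φ (Pi.single j 1) = 0 := by
      apply Fintype.linearIndependent_iff.1 hli
      rw [← hF0]
      funext z
      simp [hF]
    ext j
    simp [hzero]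
  have hfr : Module.finrank ℂ (Submodule.span ℂ (Set.range row)) = k := by
    rw [hspan, finrank_top, Module.finrank_fin_fun]
  have hex := Submodule.exists_fun_fin_finrank_span_eq ℂ (Set.range row)
  rw [hfr] at hex
  obtain ⟨f, hf1, -, hf3⟩ := hex
  choose l hl using hf1
  refine ⟨l, ?_⟩
  have : (Matrix.of fun i j => iteratedDeriv (l i) (v j) 0) = Matrix.of f := by
    ext i j
    simp [← hl, hrow]
  rw [this]
  have := (Matrix.linearIndependent_rows_iff_isUnit (A := Matrix.of f)).1 hf3
  exact ((Matrix.isUnit_iff_isUnit_det _).1 this).ne_zero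

end Wronskian

/-! ### Independent units with sum one are constant -/

section Units
open Metric Real

/-- Jensen's formula: `D` has no poles, and its zeros in the disc contribute nonnegative terms. -/
theorem log_norm_le_circleAverage {D : ℂ → ℂ} (hD : Differentiable ℂ D) (hD0 : D 0 ≠ 0) {R : ℝ}
    (hR : 0 < R) : log ‖D 0‖ ≤ circleAverage (fun z => log ‖D z‖) 0 R := by
  have han : AnalyticOnNhd ℂ D (closedBall 0 |R|) := fun z _ => hD.analyticAt z
  rw [han.circleAverage_log_norm hR.ne' hD0, le_add_iff_nonneg_left]
  apply finsum_nonneg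
  intro u
  by_cases hu : u ∈ closedBall (0 : ℂ) |R|
  · apply mul_nonneg
    · exact_mod_cast MeromorphicOn.AnalyticOnNhd.divisor_nonneg han u
    · rw [abs_of_pos hR, mem_closedBall_zero_iff] at hu
      rw [zero_sub, norm_neg]
      rcases eq_or_ne u 0 with rfl | h0
      · simp
      · apply log_nonneg
        rw [← div_eq_mul_inv, le_div_iff₀ (norm_pos_iff.2 h0)]
        linarith
  · rw [Function.locallyFinsuppWithin.apply_eq_zero_of_notMem _ hu]
    simp

/-- Since `|Re p| = 2 * max (Re p) 0 - Re p` and `Re p` has the mean value property, only the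
positive part matters. Off the zeros of `D` it is at most `Λ - log ‖D z‖`, and Jensen's inequality
bounds the average of this. -/
theorem circleAverage_abs_re_le {p D : ℂ → ℂ} (hp : Differentiable ℂ p) (hD : Differentiable ℂ D)
    (hD0 : D 0 ≠ 0) {R Λ : ℝ} (hR : 0 < R) (h1 : ∀ z, ‖z‖ = R → ‖D z‖ ≤ exp Λ)
    (h2 : ∀ z, ‖z‖ = R → ‖D z‖ * exp (p z).re ≤ exp Λ) :
    circleAverage (fun z => |(p z).re|) 0 R ≤ 2 * (Λ - log ‖D 0‖) + |(p 0).re| := by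
  have hrec : Continuous fun z => (p z).re := Complex.continuous_re.comp hp.continuous
  have hlogD : CircleIntegrable (fun z => log ‖D z‖) 0 R :=
    MeromorphicOn.circleIntegrable_log_norm fun z _ => (hD.analyticAt z).meromorphicAt
  have hmean : circleAverage (fun z => (p z).re) 0 R = (p 0).re := by
    have h := DiffContOnCl.circleAverage (f := p) (c := 0) (R := R)
      (hp.diffContOnCl)
    rw [← h]
    exact Complex.reCLM.circleAverage_comp_comm hp.continuous.continuousOn.circleIntegrable'
  set P : ℂ → ℝ := fun z => max (p z).re 0 with hP
  have hPc : Continuous P := hrec.max continuous_const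
  have hPint : CircleIntegrable P 0 R := hPc.continuousOn.circleIntegrable'
  have hPle : circleAverage P 0 R ≤ Λ - log ‖D 0‖ := by
    -- At a zero of `D` the value `log 0 = 0` need not give the desired bound. `Q` corrects `P` at
    -- these points, which form a discrete set and do not affect the average.
    set Q : ℂ → ℝ := fun z => if D z = 0 then min (P z) (Λ - log ‖D z‖) else P z with hQ
    have hcod : P =ᶠ[Filter.codiscreteWithin (sphere 0 |R|)] Q := by
      have h3 : D ⁻¹' {0}ᶜ ∈ Filter.codiscrete ℂ :=
        AnalyticOnNhd.preimage_zero_mem_codiscrete (fun z _ => hD.analyticAt z) hD0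
      have h4 := Filter.codiscreteWithin_mono (Set.subset_univ (sphere (0 : ℂ) |R|)) h3
      filter_upwards [h4] with z hz
      have : D z ≠ 0 := hz
      simp [hQ, this]
    have hQint : CircleIntegrable Q 0 R := hPint.congr_codiscreteWithin hcod
    rw [circleAverage_congr_codiscreteWithin hcod hR.ne']
    have h5 : circleAverage Q 0 R ≤ circleAverage (fun z => Λ - log ‖D z‖) 0 R := by
      apply circleAverage_mono hQint ((circleIntegrable_const Λ _ _).sub hlogD)
      intro z hz
      rw [abs_of_pos hR, mem_sphere_zero_iff_norm] at hz
      by_cases hz0 : D z = 0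
      · show Q z ≤ Λ - log ‖D z‖
        simp only [hQ, hz0, if_true]
        exact min_le_right _ _
      · show Q z ≤ Λ - log ‖D z‖
        simp only [hQ, hz0, if_false]
        have hpos : 0 < ‖D z‖ := norm_pos_iff.2 hz0
        apply max_le
        · have := log_le_log (by positivity) (h2 z hz)
          rw [log_mul hpos.ne' (exp_ne_zero _), log_exp, log_exp] at this
          linarith
        · have := log_le_log hpos (h1 z hz)
          rw [log_exp] at this
          linarith
    rw [circleAverage_fun_sub (circleIntegrable_const _ _ _) hlogD, circleAverage_const] at h5
    have := log_norm_le_circleAverage hD hD0 hR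
    linarith
  have heq : (fun z => |(p z).re|) = fun z => 2 * P z - (p z).re := by
    funext z
    simp only [hP]
    rcases le_total (p z).re 0 with h | h
    · rw [abs_of_nonpos h, max_eq_right h]; ring
    · rw [abs_of_nonneg h, max_eq_left h]; ring
  rw [heq, circleAverage_fun_sub ((hPc.const_mul 2).continuousOn.circleIntegrable')
    hrec.continuousOn.circleIntegrable', hmean]
  have : circleAverage (fun z => 2 * P z) 0 R = 2 * circleAverage P 0 R := by
    simpa using circleAverage_fun_smul (a := (2 : ℝ)) (f := P) (c := 0) (R := R)
  rw [this]
  have := neg_abs_le (p 0).re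
  linarith

theorem exists_entire_log {v : ℂ → ℂ} (hv : Differentiable ℂ v) (hv0 : ∀ z, v z ≠ 0) :
    ∃ p : ℂ → ℂ, Differentiable ℂ p ∧ ∀ z, v z = Complex.exp (p z) := by
  have hd : Differentiable ℂ (deriv v) :=
    (hv.contDiff (n := 2)).differentiable_deriv_two
  obtain ⟨g, hg⟩ := (hd.div hv hv0).isExactOn_univ
  have hg' : ∀ z, HasDerivAt g (deriv v z / v z) z := fun z => hg z (Set.mem_univ z)
  have hgd : Differentiable ℂ g := fun z => (hg' z).differentiableAt
  have hconst : ∀ z, v z * Complex.exp (-g z) = v 0 * Complex.exp (-g 0) := by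
    intro z
    apply is_const_of_deriv_eq_zero (f := fun z => v z * Complex.exp (-g z))
    · exact hv.mul (Complex.differentiable_exp.comp hgd.neg)
    · intro x
      have h1 : HasDerivAt (fun z => v z * Complex.exp (-g z)) _ x :=
        (hv x).hasDerivAt.mul (hg' x).fun_neg.cexp
      rw [h1.deriv]
      have := hv0 x
      field_simp
      ring
  set c := v 0 * Complex.exp (-g 0) with hc
  have hc0 : c ≠ 0 := mul_ne_zero (hv0 0) (Complex.exp_ne_zero _)
  refine ⟨fun z => g z + Complex.log c, hgd.add_const _, fun z => ?_⟩
  rw [Complex.exp_add, Complex.exp_log hc0, ← hconst z, mul_comm, mul_assoc, ← Complex.exp_add]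
  simp


theorem norm_det_le {k : ℕ} {M : Matrix (Fin k) (Fin k) ℂ} {B : ℝ} (hM : ∀ i j, ‖M i j‖ ≤ B) :
    ‖M.det‖ ≤ k.factorial * B ^ k := by
  have : ‖M.det‖ ≤ (Fintype.card (Fin k)).factorial • B ^ Fintype.card (Fin k) :=
    Matrix.det_le (abv := NormedField.toAbsoluteValue ℂ) (A := M) (x := B) hM
  simpa using this

theorem differentiable_det {k : ℕ} {M : ℂ → Matrix (Fin k) (Fin k) ℂ}
    (hM : ∀ i j, Differentiable ℂ fun z => M z i j) : Differentiable ℂ fun z => (M z).det := by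
  simp only [Matrix.det_apply]
  apply Differentiable.fun_sum
  intro σ _
  apply Differentiable.const_smul
  apply Differentiable.fun_finsetProd
  intro i _
  exact hM _ _

/-- A supremum bound for `G` on closed discs about the origin. -/
theorem exists_monotone_bound {G : ℂ → ℝ} (hG : Continuous G) (hG0 : ∀ z, 0 ≤ G z) :
    ∃ A : ℝ → ℝ, (∀ r, 0 ≤ A r) ∧ (∀ r s, 0 < r → r ≤ s → A r ≤ A s) ∧
      (∀ r z, ‖z‖ ≤ r → G z ≤ A r) ∧ ∀ r B, 0 < r → (∀ z, ‖z‖ ≤ r → G z ≤ B) → A r ≤ B := by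
  have hbdd : ∀ r, BddAbove (G '' closedBall 0 r) := fun r =>
    ((isCompact_closedBall 0 r).image hG).bddAbove
  have hne : ∀ r : ℝ, 0 < r → (G '' closedBall 0 r).Nonempty := fun r hr =>
    (nonempty_closedBall.2 hr.le).image _
  refine ⟨fun r => sSup (G '' closedBall 0 r), ?_, ?_, ?_, ?_⟩
  · intro r
    apply Real.sSup_nonneg
    rintro _ ⟨z, -, rfl⟩
    exact hG0 z
  · intro r s hr hrs
    exact csSup_le_csSup (hbdd s) (hne r hr) (Set.image_mono (closedBall_subset_closedBall hrs))
  · intro r z hz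
    exact le_csSup (hbdd r) ⟨z, by simpa using hz, rfl⟩
  · intro r B hr h
    apply csSup_le (hne r hr)
    rintro _ ⟨z, hz, rfl⟩
    exact h z (by simpa using hz)

/-- Linearly independent nowhere vanishing entire functions with sum `1` are constant. -/
theorem deriv_eq_zero_of_linearIndependent_of_sum_eq_one {k : ℕ} {v : Fin k → ℂ → ℂ}
    (hv : ∀ j, Differentiable ℂ (v j)) (hv0 : ∀ j z, v j z ≠ 0) (hli : LinearIndependent ℂ v)
    (hsum : ∀ z, ∑ j, v j z = 1) (j : Fin k) (z : ℂ) : deriv (v j) z = 0 := by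
  obtain ⟨l, hl⟩ := exists_det_iteratedDeriv_ne_zero hv hli
  choose p hp hvp using fun j => exists_entire_log (hv j) (hv0 j)
  have hlog : ∀ j z, deriv (v j) z / v j z = deriv (p j) z := by
    intro j z
    have h1 : HasDerivAt (v j) (Complex.exp (p j z) * deriv (p j) z) z := by
      have : v j = fun z => Complex.exp (p j z) := funext (hvp j)
      rw [this]
      exact (hp j z).hasDerivAt.cexp
    rw [h1.deriv, hvp]
    field_simp [Complex.exp_ne_zero]
  have hpd : ∀ j, Differentiable ℂ (deriv (p j)) := fun j =>
    ((hp j).contDiff (n := 2)).differentiable_deriv_two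
  set G : ℂ → ℝ := fun z => ∑ j, ‖deriv (p j) z‖ with hG
  have hGc : Continuous G := continuous_finsetSum _ fun j _ => (hpd j).continuous.norm
  have hGj : ∀ j z, ‖deriv (p j) z‖ ≤ G z := fun j z =>
    Finset.single_le_sum (f := fun j => ‖deriv (p j) z‖) (fun _ _ => norm_nonneg _)
      (Finset.mem_univ j)
  obtain ⟨A, hA0, hAmono, hAle, hAleast⟩ := exists_monotone_bound hGc fun z =>
    Finset.sum_nonneg fun j _ => norm_nonneg (deriv (p j) z)
  have hditer : ∀ i j, Differentiable ℂ (iteratedDeriv i (v j)) := fun i j =>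
    ((hv j).contDiff (n := ((i + 1 : ℕ) : WithTop ℕ∞))).differentiable_iteratedDeriv i
        (by exact_mod_cast Nat.lt_succ_self i)
  -- The columns are divided by the `v j`, so that all entries are controlled by logarithmic
  -- derivatives. Differentiating the sum gives `M v = e` with `e` a vector of zeros and ones. By
  -- Cramer's rule both `D` and `D * v j` are then determinants with controlled entries, as
  -- `circleAverage_abs_re_le` requires.
  set M : ℂ → Matrix (Fin k) (Fin k) ℂ := fun z =>
    Matrix.of fun i j => (v j z)⁻¹ * iteratedDeriv (l i) (v j) z with hM
  have hMd : ∀ i j, Differentiable ℂ fun z => M z i j := fun i j =>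
    ((hv j).inv (hv0 j)).mul (hditer (l i) j)
  set D : ℂ → ℂ := fun z => (M z).det with hD
  have hDd : Differentiable ℂ D := differentiable_det hMd
  have hD0 : D 0 ≠ 0 := by
    simp only [hD, hM]
    have := Matrix.det_mul_row (fun j => (v j 0)⁻¹)
      (Matrix.of fun i j => iteratedDeriv (l i) (v j) 0)
    simp only [Matrix.of_apply] at this
    rw [this]
    exact mul_ne_zero (Finset.prod_ne_zero_iff.2 fun j _ => inv_ne_zero (hv0 j 0)) hl
  set e : Fin k → ℂ := fun i => if l i = 0 then 1 else 0 with he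
  have hMv : ∀ z, (M z).mulVec (fun j => v j z) = e := by
    intro z
    funext i
    have h1 : (M z).mulVec (fun j => v j z) i = iteratedDeriv (l i) (fun z => ∑ j, v j z) z := by
      rw [iteratedDeriv_fun_sum fun j _ => (hv j).contDiff.contDiffAt]
      simp only [Matrix.mulVec, dotProduct, hM, Matrix.of_apply]
      apply Finset.sum_congr rfl
      intro j _
      have := hv0 j z
      field_simp
    rw [h1, show (fun z => ∑ j, v j z) = fun _ => (1 : ℂ) from funext hsum, iteratedDeriv_const]
  have hcramer : ∀ j z, D z * v j z = ((M z).updateCol j e).det := by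
    intro j z
    rw [← Matrix.cramer_apply, ← hMv z, Matrix.cramer_eq_adjugate_mulVec, Matrix.mulVec_mulVec,
      Matrix.adjugate_mul, Matrix.smul_mulVec, Matrix.one_mulVec]
    simp [hD]
  -- A common bound for the orders of differentiation, positive so that the margin `h` can be
  -- divided into `s` steps of radius `h / s`.
  set s : ℕ := ∑ i, l i + 1 with hs
  have hls : ∀ i, l i ≤ s := fun i =>
    (Finset.single_le_sum (fun _ _ => Nat.zero_le _) (Finset.mem_univ i)).trans (Nat.le_succ _)
  have hs0 : (0 : ℝ) < s := by rw [hs]; positivity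
  have hMle : ∀ r h, 0 < r → 0 < h → ∀ z, ‖z‖ ≤ r + h → ∀ i j,
      ‖M z i j‖ ≤ (1 + A (r + 2 * h) + s / h) ^ s := by
    intro r h hr hh z hz i j
    have h1 := norm_iteratedDeriv_div_le (hv j) (hv0 j) (δ := h / s) (A := A (r + 2 * h))
      (by positivity) (l i) (r + h) (by
        intro w hw
        rw [hlog]
        refine (hGj j w).trans (hAle _ _ ?_)
        have : (l i : ℝ) * (h / s) ≤ h := by
          rw [mul_div_assoc', div_le_iff₀ hs0, mul_comm]
          have : (l i : ℝ) ≤ s := by exact_mod_cast hls i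
          gcongr
        linarith) z hz
    have h2 : M z i j = iteratedDeriv (l i) (v j) z / v j z := by
      simp only [hM, Matrix.of_apply]; rw [div_eq_inv_mul]
    rw [h2]
    refine h1.trans ?_
    have h3 : 1 / (h / s) = s / h := by field_simp
    rw [h3]
    have h4 := hA0 (r + 2 * h)
    have h5 : 0 ≤ (s : ℝ) / h := by positivity
    calc _ ≤ (1 + A (r + 2 * h) + s / h) ^ (l i) := by gcongr; linarith
      _ ≤ _ := pow_le_pow_right₀ (by linarith) (hls i)
  set C : ℝ := |Real.log ‖D 0‖| + ∑ j, |(p j 0).re| with hC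
  have hC0 : 0 ≤ C := by positivity
  have hfac : 0 ≤ Real.log k.factorial := Real.log_natCast_nonneg _
  set K : ℝ := k * (2 * (2 * (Real.log k.factorial + s * k) + 2 * C)) + 1 with hK
  have hKpos : 0 < K := by positivity
  have hmain : ∀ r h : ℝ, 0 < r → 0 < h →
      A r ≤ K * (r + h) / h ^ 2 * (1 + Real.log (1 + A (r + 2 * h) + s / h)) := by
    intro r h hr hh
    set T := 1 + A (r + 2 * h) + s / h with hT
    have hT1 : 1 ≤ T := by
      have h4 := hA0 (r + 2 * h)
      have h5 : 0 ≤ (s : ℝ) / h := by positivity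
      linarith
    have hlogT : 0 ≤ Real.log T := Real.log_nonneg hT1
    set Λ := Real.log (k.factorial * (T ^ s) ^ k) with hΛ
    have hfp : (0 : ℝ) < k.factorial := by exact_mod_cast k.factorial_pos
    have hexp : exp Λ = k.factorial * (T ^ s) ^ k := by
      rw [hΛ, exp_log]; positivity
    have hΛ' : Λ = Real.log k.factorial + s * k * Real.log T := by
      rw [hΛ, log_mul (by positivity) (by positivity), ← pow_mul, log_pow]; push_cast; ring
    have hTs : 1 ≤ T ^ s := one_le_pow₀ hT1
    have havg : ∀ j, circleAverage (fun z => |(p j z).re|) 0 (r + h) ≤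
        2 * (Λ - log ‖D 0‖) + |(p j 0).re| := by
      intro j
      apply circleAverage_abs_re_le (hp j) hDd hD0 (by positivity)
      · intro z hz
        rw [hexp]
        exact norm_det_le (hMle r h hr hh z hz.le)
      · intro z hz
        rw [← Complex.norm_exp, ← hvp, ← norm_mul, hcramer, hexp]
        apply norm_det_le
        intro i j'
        rw [Matrix.updateCol_apply]
        split_ifs
        · refine le_trans ?_ hTs
          simp only [he]
          split_ifs <;> simp
        · exact hMle r h hr hh z hz.le i j'
    have havg' : ∀ j, circleAverage (fun z => |(p j z).re|) 0 (r + h) ≤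
        (2 * (Real.log k.factorial + s * k) + 2 * C) * (1 + Real.log T) := by
      intro j
      refine (havg j).trans ?_
      have h1 : |(p j 0).re| ≤ ∑ j, |(p j 0).re| :=
        Finset.single_le_sum (f := fun j => |(p j 0).re|) (fun _ _ => abs_nonneg _)
          (Finset.mem_univ j)
      have h2 := neg_abs_le (Real.log ‖D 0‖)
      have h3 : 0 ≤ |(p j 0).re| := abs_nonneg _
      have h4 : 0 ≤ (s : ℝ) * k := by positivity
      have h5 : 0 ≤ C * Real.log T := by positivity
      have h6 : 0 ≤ Real.log k.factorial * Real.log T := by positivity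
      have h7 : 0 ≤ ∑ j, |(p j 0).re| := h3.trans h1
      rw [hΛ']
      nlinarith
    apply hAleast r _ hr
    intro z hz
    have hsub : h ≤ r + h - ‖z‖ := by linarith
    have hterm : ∀ j ∈ Finset.univ, ‖deriv (p j) z‖ ≤ 2 * (r + h) / h ^ 2 *
        ((2 * (Real.log k.factorial + s * k) + 2 * C) * (1 + Real.log T)) := by
      intro j _
      refine (norm_deriv_le_circleAverage_abs_re (hp j) (R := r + h) (by linarith)).trans ?_
      apply mul_le_mul _ (havg' j) _ (by positivity)
      · gcongr
      · apply circleAverage_nonneg_of_nonneg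
        intro w _
        exact abs_nonneg _
    refine (Finset.sum_le_card_nsmul _ _ _ hterm).trans ?_
    rw [Finset.card_univ, Fintype.card_fin, nsmul_eq_mul, hK]
    have : 0 ≤ (r + h) / h ^ 2 * (1 + Real.log T) := by positivity
    have h9 : (k : ℝ) * (2 * (r + h) / h ^ 2 * ((2 * (Real.log k.factorial + s * k) + 2 * C) *
        (1 + Real.log T))) = k * (2 * (2 * (Real.log k.factorial + s * k) + 2 * C)) *
          ((r + h) / h ^ 2 * (1 + Real.log T)) := by ring
    rw [h9]
    calc _ ≤ (k * (2 * (2 * (Real.log k.factorial + s * k) + 2 * C)) + 1) *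
          ((r + h) / h ^ 2 * (1 + Real.log T)) := by gcongr; linarith
      _ = _ := by ring
  have hfin : A (‖z‖ + 1) = 0 := eq_zero_of_log_growth hKpos hs0 hAmono hA0 hmain (by positivity)
  have h1 : ‖deriv (p j) z‖ ≤ 0 := by
    rw [← hfin]
    exact (hGj j z).trans (hAle _ _ (by linarith))
  have h2 := hlog j z
  rw [norm_le_zero_iff.1 h1, div_eq_zero_iff] at h2
  exact h2.resolve_right (hv0 j z)

end Units

/-! ### Borel's theorem -/

section Borel

/-- **Borel's theorem** for nowhere vanishing entire functions of one variable. -/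
theorem borel_entire {ι : Type*} [Fintype ι] {u : ι → ℂ → ℂ} (hu : ∀ i, Differentiable ℂ (u i))
    (hu0 : ∀ i z, u i z ≠ 0) (hsum : ∀ z, ∑ i, u i z = 0) (i : ι) :
    ∃ j, j ≠ i ∧ ∃ c : ℂ, ∀ z, u i z = c * u j z := by
  classical
  have hmem : u i ∈ Submodule.span ℂ (u '' {j | j ≠ i}) := by
    have h1 : u i = -∑ j ∈ Finset.univ.erase i, u j := by
      funext z
      have := hsum z
      rw [← Finset.add_sum_erase _ _ (Finset.mem_univ i)] at this
      simp only [Pi.neg_apply, Finset.sum_apply]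
      exact eq_neg_of_add_eq_zero_left this
    rw [h1]
    apply Submodule.neg_mem
    apply Submodule.sum_mem
    intro j hj
    exact Submodule.subset_span ⟨j, (Finset.mem_erase.1 hj).1, rfl⟩
  -- Write `u i` in terms of independent functions among the others and divide by `u i`. The nonzero
  -- terms are independent units with sum `1`, hence constants, and any one of them exhibits the
  -- proportionality.
  obtain ⟨b, hb, hspan, hli⟩ := exists_linearIndependent ℂ (u '' {j | j ≠ i})
  rw [← hspan, Submodule.mem_span_set] at hmem
  obtain ⟨c, hcb, hc⟩ := hmem
  set e := c.support.equivFin.symm with he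
  have hTu : ∀ w ∈ c.support, ∃ j, j ≠ i ∧ u j = w := fun w hw => by
    obtain ⟨j, hj, rfl⟩ := hb (hcb hw)
    exact ⟨j, hj, rfl⟩
  set v : Fin c.support.card → ℂ → ℂ := fun a z => c (e a) * (e a : ℂ → ℂ) z / u i z with hv
  have hw : ∀ a, Differentiable ℂ (e a : ℂ → ℂ) ∧ ∀ z, (e a : ℂ → ℂ) z ≠ 0 := fun a => by
    obtain ⟨j, -, hj⟩ := hTu _ (e a).2
    rw [← hj]
    exact ⟨hu j, hu0 j⟩
  have hca : ∀ a, c (e a) ≠ 0 := fun a => Finsupp.mem_support_iff.1 (e a).2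
  have hvd : ∀ a, Differentiable ℂ (v a) := fun a =>
    ((hw a).1.const_mul _).div (hu i) (hu0 i)
  have hv0 : ∀ a z, v a z ≠ 0 := fun a z =>
    div_ne_zero (mul_ne_zero (hca a) ((hw a).2 z)) (hu0 i z)
  have hvsum : ∀ z, ∑ a, v a z = 1 := by
    intro z
    have h1 : ∑ a, c (e a) * (e a : ℂ → ℂ) z = u i z := by
      rw [← hc, Finsupp.sum, Finset.sum_apply, ← Finset.sum_coe_sort c.support]
      exact Fintype.sum_equiv e (fun a => c (e a) * (e a : ℂ → ℂ) z)
        (fun w : c.support => (c w • (w : ℂ → ℂ)) z) fun a => rfl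
    simp only [hv]
    rw [← Finset.sum_div, h1, div_self (hu0 i z)]
  have hvli : LinearIndependent ℂ v := by
    rw [Fintype.linearIndependent_iff]
    intro g hg a
    have hli' : LinearIndependent ℂ fun a => (e a : ℂ → ℂ) := by
      have := hli.comp (fun a => (⟨(e a : ℂ → ℂ), hcb (e a).2⟩ : b)) (by
        intro a a' h
        apply e.injective
        apply Subtype.ext
        simpa using h)
      exact this
    have h2 := Fintype.linearIndependent_iff.1 hli' (fun a => g a * c (e a)) (by
      funext z
      have h3 := congrFun hg z
      simp only [Finset.sum_apply, Pi.smul_apply, smul_eq_mul, Pi.zero_apply, hv] at h3 ⊢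
      have h4 : ∑ a, g a * c (e a) * (e a : ℂ → ℂ) z =
          u i z * ∑ a, g a * (c (e a) * (e a : ℂ → ℂ) z / u i z) := by
        rw [Finset.mul_sum]
        apply Finset.sum_congr rfl
        intro a _
        have := hu0 i z
        field_simp
      rw [h4, h3, mul_zero]) a
    exact (mul_eq_zero.1 h2).resolve_right (hca a)
  have hne : Nonempty (Fin c.support.card) := by
    by_contra h
    rw [not_nonempty_iff] at h
    have := hvsum 0
    simp at this
  obtain ⟨a⟩ := hne
  obtain ⟨j, hji, hj⟩ := hTu _ (e a).2
  refine ⟨j, hji, c (e a) / v a 0, fun z => ?_⟩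
  have h5 : v a z = v a 0 := is_const_of_deriv_eq_zero (hvd a)
    (deriv_eq_zero_of_linearIndependent_of_sum_eq_one hvd hv0 hvli hvsum a) z 0
  have h6 : v a 0 * u i z = c (e a) * u j z := by
    rw [← h5, hj]
    simp only [hv]
    rw [div_mul_cancel₀ _ (hu0 i z)]
  rw [div_mul_eq_mul_div, ← h6, mul_div_cancel_left₀ _ (hv0 a 0)]

variable {E : Type*} [NormedAddCommGroup E] [NormedSpace ℂ E]

theorem dense_ne_zero_of_analytic {F : E → ℂ} (hF : AnalyticOnNhd ℂ F Set.univ) {a : E}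
    (ha : F a ≠ 0) : Dense {z | F z ≠ 0} := by
  rw [← Set.compl_ofPred, ← interior_eq_empty_iff_dense_compl]
  by_contra hne
  obtain ⟨z, hz⟩ := Set.nonempty_iff_ne_empty.2 hne
  have h1 : F =ᶠ[nhds z] 0 := mem_interior_iff_mem_nhds.1 hz
  exact ha (hF.eqOn_zero_of_preconnected_of_eventuallyEq_zero isPreconnected_univ
    (Set.mem_univ z) h1 (Set.mem_univ a))

/-- **Borel's theorem** for nowhere vanishing entire functions on a complex Banach space. -/
theorem borel_analytic [CompleteSpace E] {ι : Type*} [Fintype ι] {u : ι → E → ℂ}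
    (hu : ∀ i, AnalyticOnNhd ℂ (u i) Set.univ) (hu0 : ∀ i z, u i z ≠ 0)
    (hsum : ∀ z, ∑ i, u i z = 0) (i : ι) : ∃ j, j ≠ i ∧ ∃ c : ℂ, ∀ z, u i z = c * u j z := by
  by_contra! hcon
  -- Reduction to one variable. If `u i` is proportional to no other `u j`, then by Baire some `z`
  -- witnesses this for all `j` simultaneously on the line `ℂ z`, against the entire case.
  have hdense : Dense (⋂ j : {j // j ≠ i}, {z | u i z * u j 0 - u i 0 * u j z ≠ 0}) := by
    apply dense_iInter_of_isOpen
    · intro j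
      apply isOpen_ne_fun _ continuous_const
      have h1 := fun i => (continuousOn_univ.1 (hu i).continuousOn)
      exact ((h1 i).mul continuous_const).sub (continuous_const.mul (h1 j))
    · intro j
      obtain ⟨z, hz⟩ := hcon j j.2 (u i 0 / u j 0)
      apply dense_ne_zero_of_analytic (a := z)
      · exact ((hu i).mul analyticOnNhd_const).sub (analyticOnNhd_const.mul (hu j))
      · intro h
        apply hz
        rw [div_mul_eq_mul_div, eq_div_iff (hu0 j 0)]
        exact sub_eq_zero.1 h
  obtain ⟨z, hz⟩ := hdense.nonempty
  obtain ⟨j, hji, c, hc⟩ := borel_entire (u := fun i (t : ℂ) => u i (t • z))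
    (fun i => by
      have h1 : Differentiable ℂ (u i) := fun w => (hu i w (Set.mem_univ w)).differentiableAt
      exact h1.comp (differentiable_id.smul_const z))
    (fun i t => hu0 i _) (fun t => hsum _) i
  apply Set.mem_iInter.1 hz ⟨j, hji⟩
  have h0 := hc 0
  have h1 := hc 1
  simp only [zero_smul, one_smul] at h0 h1
  rw [h0, h1]
  ring

end Borel

/-! ### Combinatorics of the exchange property -/

section Combinatorics

/-- A finite family in a commutative group generating a torsion-free subgroup has the same
multiplicative relations as a family in a linearly ordered group. -/
theorem exists_lex_relations {G : Type*} [CommGroup G] {q : ℕ} (α : Fin q → G)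
    (htf : ∀ g ∈ Subgroup.closure (Set.range α), ∀ k : ℕ, k ≠ 0 → g ^ k = 1 → g = 1) :
    ∃ (ρ : ℕ) (w : Fin q → Lex (Fin ρ → ℤ)),
      ∀ a : Fin q → ℤ, ∑ j, a j • w j = 0 ↔ ∏ j, α j ^ a j = 1 := by
  set S := Subgroup.closure (Set.range α) with hS
  have : Group.FG S := (Group.fg_iff_subgroup_fg S).2 ⟨(Set.finite_range α).toFinset, by simp [hS]⟩
  have : Module.Finite ℤ (Additive S) := Module.Finite.iff_addGroup_fg.2 inferInstance
  have htf' : IsMulTorsionFree S := by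
    refine ⟨fun k hk a b hab => ?_⟩
    have h1 : (a / b) ^ k = 1 := by rw [div_pow, div_eq_one]; exact hab
    rw [← div_eq_one]
    exact Subtype.ext (htf _ (a / b).2 k hk (by exact_mod_cast congrArg Subtype.val h1))
  set b := Module.finBasis ℤ (Additive S)
  set γ : Fin q → Additive S := fun j => Additive.ofMul ⟨α j, Subgroup.subset_closure ⟨j, rfl⟩⟩
  refine ⟨_, fun j => toLex (b.equivFun (γ j)), fun a => ?_⟩
  have h1 : ∑ j, a j • toLex (b.equivFun (γ j)) = toLex (b.equivFun (∑ j, a j • γ j)) := by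
    simp only [map_sum, map_smul]
    rfl
  have h2 : (((∑ j, a j • γ j : Additive S).toMul : S) : G) = ∏ j, α j ^ a j := by
    simp [γ]
  rw [h1, ← h2, OneMemClass.coe_eq_one, toMul_eq_one]
  exact (toLex_inj (b := (0 : Fin _ → ℤ))).trans b.equivFun.map_eq_zero_iff

variable {Γ : Type*} [AddCommGroup Γ]

/-- Fujimoto's exchange property of a family of elements of an abelian group: in any `n + N + 2`
members, no sum of `N + 1` members occurs only once. -/
def ExchangeProperty {Γ : Type*} [AddCommMonoid Γ] {q : ℕ} (n N : ℕ) (w : Fin q → Γ) : Prop :=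
  ∀ J : Finset (Fin q), J.card = n + N + 2 → ∀ I ⊆ J, I.card = N + 1 →
    ∃ I' ⊆ J, I'.card = N + 1 ∧ I' ≠ I ∧ ∑ i ∈ I', w i = ∑ i ∈ I, w i

theorem ExchangeProperty.neg {q n N : ℕ} {w : Fin q → Γ} (h : ExchangeProperty n N w) :
    ExchangeProperty n N (-w) := by
  intro J hJ I hI hIc
  obtain ⟨I', h1, h2, h3, h4⟩ := h J hJ I hI hIc
  exact ⟨I', h1, h2, h3, by simp [h4]⟩

theorem ExchangeProperty.comp_perm {q n N : ℕ} {w : Fin q → Γ} (h : ExchangeProperty n N w)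
    (σ : Equiv.Perm (Fin q)) : ExchangeProperty n N (w ∘ σ) := by
  intro J hJ I hI hIc
  obtain ⟨I', h1, h2, h3, h4⟩ := h (J.map σ.toEmbedding) (by simpa using hJ) (I.map σ.toEmbedding)
    (Finset.map_subset_map.2 hI) (by simpa using hIc)
  have hI' : (I'.map σ.symm.toEmbedding).map σ.toEmbedding = I' := by
    rw [Finset.map_map]; ext; simp
  refine ⟨I'.map σ.symm.toEmbedding, ?_, by simpa using h2, ?_, ?_⟩
  · rw [← Finset.map_subset_map (f := σ.toEmbedding), hI']; exact h1
  · rintro rfl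
    exact h3 hI'.symm
  · rw [Finset.sum_map] at h4
    rw [Finset.sum_map]
    simpa using h4

theorem sum_sdiff_eq_sum_sdiff {q : ℕ} {w : Fin q → Γ} {I I' : Finset (Fin q)}
    (h : ∑ i ∈ I', w i = ∑ i ∈ I, w i) : ∑ i ∈ I' \ I, w i = ∑ i ∈ I \ I', w i := by
  have h1 := Finset.sum_inter_add_sum_sdiff I I' w
  have h2 := Finset.sum_inter_add_sum_sdiff I' I w
  rw [Finset.inter_comm, h, ← h1] at h2
  exact add_left_cancel h2

variable [LinearOrder Γ] [IsOrderedAddMonoid Γ]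

/-- If `c < d`, trading members of `A` for members of `B` strictly increases the sum, so the sum
over `A` would occur only once in `A ∪ B`. -/
theorem ExchangeProperty.le_of_forall_le {q n N : ℕ} {w : Fin q → Γ}
    (h : ExchangeProperty n N w) {A B : Finset (Fin q)} (hAB : Disjoint A B)
    (hA : A.card = N + 1) (hB : B.card = n + 1) {c d : Γ} (hc : ∀ a ∈ A, w a ≤ c)
    (hd : ∀ b ∈ B, d ≤ w b) : d ≤ c := by
  obtain ⟨I', h1, h2, h3, h4⟩ := h (A ∪ B) (by rw [Finset.card_union_of_disjoint hAB]; omega) A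
    Finset.subset_union_left hA
  have h5 := sum_sdiff_eq_sum_sdiff h4
  have hcard : (I' \ A).card = (A \ I').card := Finset.card_sdiff_comm (h2.trans hA.symm)
  have hpos : (I' \ A).card ≠ 0 := by
    intro h0
    rw [Finset.card_eq_zero, Finset.sdiff_eq_empty_iff_subset] at h0
    exact h3 (Finset.eq_of_subset_of_card_le h0 (by omega))
  by_contra! hcd
  have h6 : (A \ I').card • d ≤ ∑ i ∈ I' \ A, w i := by
    rw [← hcard]
    apply Finset.card_nsmul_le_sum
    intro i hi
    rw [Finset.mem_sdiff] at hi
    exact hd i ((Finset.mem_union.1 (h1 hi.1)).resolve_left hi.2)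
  have h7 : ∑ i ∈ A \ I', w i ≤ (A \ I').card • c := by
    apply Finset.sum_le_card_nsmul
    intro i hi
    exact hc i (Finset.mem_sdiff.1 hi).1
  have h8 : (A \ I').card • c < (A \ I').card • d :=
    nsmul_lt_nsmul_right (by omega) hcd
  exact absurd (h6.trans (h5.trans_le h7)) h8.not_ge

/-- The indices in `[a, b)`. -/
def finIco {q : ℕ} (a b : ℕ) (hb : b ≤ q) : Finset (Fin q) :=
  (Finset.Ico a b).attachFin fun _ hm => (Finset.mem_Ico.1 hm).2.trans_le hb

theorem mem_finIco {q a b : ℕ} {hb : b ≤ q} {j : Fin q} :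
    j ∈ finIco a b hb ↔ a ≤ j ∧ (j : ℕ) < b := by
  simp [finIco]

theorem card_finIco {q a b : ℕ} (hb : b ≤ q) : (finIco a b hb).card = b - a := by
  simp [finIco]

theorem disjoint_finIco {q a b c d : ℕ} {hb : b ≤ q} {hd : d ≤ q} (h : b ≤ c) :
    Disjoint (finIco a b hb) (finIco c d hd) := by
  rw [Finset.disjoint_left]
  intro j h1 h2
  rw [mem_finIco] at h1 h2
  omega

/-- There are `n + 1` indices with the same weight `e` and, in addition, one more such index, or
two further indices of equal weight, or few further indices of mean weight `e`. -/
def HasHeavyClass {Γ : Type*} [AddCommGroup Γ] {q : ℕ} (n N : ℕ) (w : Fin q → Γ) : Prop :=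
  ∃ (E : Finset (Fin q)) (e : Γ), E.card = n + 1 ∧ (∀ j ∈ E, w j = e) ∧
    ((∃ t ∉ E, w t = e) ∨ (∃ s ∉ E, ∃ t ∉ E, s ≠ t ∧ w s = w t) ∨
      ∃ K : Finset (Fin q), Disjoint K E ∧ K.Nonempty ∧ K.card ≤ N - n + 2 ∧ K.card ≤ n + 1 ∧
        ∑ j ∈ K, w j = K.card • e)

/-- There are two disjoint nonempty sets of indices, each of constant weight, with `n + 3` members
altogether. -/
def HasTwoClasses {Γ : Type*} {q : ℕ} (n : ℕ) (w : Fin q → Γ) : Prop :=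
  ∃ X Y : Finset (Fin q), Disjoint X Y ∧ X.Nonempty ∧ Y.Nonempty ∧ X.card + Y.card = n + 3 ∧
    (∃ c, ∀ j ∈ X, w j = c) ∧ ∃ d, ∀ j ∈ Y, w j = d

/-- The borderline case `q = 3 * n + 1`, where exactly the middle `n + 1` weights equal `e`.
Exchange is applied to the lowest `n - 1` indices `Y` with a block `Z` of weight `e`, leaving out
the index `l = n - 1`. Measured from `e`, the added indices contribute at least `w l - e`, because
only `l` is negative. Removing a member of `Y` would contribute strictly less. So only members of
`Z` are removed, and the added indices have mean weight `e`. -/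
theorem ExchangeProperty.exists_sum_eq_of_monotone {n N : ℕ} {w : Fin (3 * n + 1) → Γ}
    (h : ExchangeProperty n N w) (hw : Monotone w) (hn : 1 ≤ n) (hnN : n ≤ N) (hN : N + 1 ≤ 2 * n)
    {e : Γ} (he : ∀ j ∈ finIco n (2 * n + 1) (by omega : 2 * n + 1 ≤ 3 * n + 1), w j = e)
    (hne : ∀ t ∉ finIco n (2 * n + 1) (by omega : 2 * n + 1 ≤ 3 * n + 1), w t ≠ e)
    (hinj : ∀ s ∉ finIco n (2 * n + 1) (by omega : 2 * n + 1 ≤ 3 * n + 1),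
      ∀ t ∉ finIco n (2 * n + 1) (by omega : 2 * n + 1 ≤ 3 * n + 1), s ≠ t → w s ≠ w t) :
    ∃ K : Finset (Fin (3 * n + 1)),
      Disjoint K (finIco n (2 * n + 1) (by omega : 2 * n + 1 ≤ 3 * n + 1)) ∧ K.Nonempty ∧
        K.card ≤ N - n + 2 ∧ ∑ j ∈ K, w j = K.card • e := by
  have hzero : ∀ j : Fin (3 * n + 1), n ≤ (j : ℕ) → (j : ℕ) < 2 * n + 1 → w j = e := fun j h1 h2 =>
    he j (mem_finIco.2 ⟨h1, h2⟩)
  set m : Fin (3 * n + 1) := ⟨n, by omega⟩ with hm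
  set l : Fin (3 * n + 1) := ⟨n - 1, by omega⟩ with hl
  have hwm : w m = e := hzero m le_rfl (by simp only [hm]; omega)
  have hle : ∀ j : Fin (3 * n + 1), (j : ℕ) ≤ n → w j ≤ e := fun j hj => hwm ▸ hw (Fin.le_def.2 hj)
  have hge : ∀ j : Fin (3 * n + 1), n ≤ (j : ℕ) → e ≤ w j := fun j hj => hwm ▸ hw (Fin.le_def.2 hj)
  have hlE : l ∉ finIco n (2 * n + 1) (by omega : 2 * n + 1 ≤ 3 * n + 1) := by
    rw [mem_finIco]; simp only [hl]; omega
  have hll : w l < e := lt_of_le_of_ne (hle l (by simp only [hl]; omega)) (hne l hlE)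
  have hlt : ∀ j : Fin (3 * n + 1), (j : ℕ) < n - 1 → w j < w l := fun j hj =>
    lt_of_le_of_ne (hw (Fin.le_def.2 (by simp only [hl]; omega)))
      (hinj j (by rw [mem_finIco]; omega) l hlE (by
        intro h; rw [h] at hj; simp only [hl] at hj; omega))
  set Z := finIco n (N + 2) (by omega : N + 2 ≤ 3 * n + 1) with hZ
  set Y := finIco 0 (n - 1) (by omega : n - 1 ≤ 3 * n + 1) with hY
  set J := finIco 0 (N + 2) (by omega : N + 2 ≤ 3 * n + 1) ∪
    finIco (2 * n + 1) (3 * n + 1) (le_refl _) with hJ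
  have hYZ : Disjoint Y Z := disjoint_finIco (by omega)
  obtain ⟨I', h1, h2, h3, h4⟩ := h J
    (by rw [hJ, Finset.card_union_of_disjoint (disjoint_finIco (by omega)), card_finIco,
          card_finIco]; omega) (Y ∪ Z)
    (by
      intro j hj
      simp only [hY, hZ, hJ, Finset.mem_union, mem_finIco] at hj ⊢
      omega)
    (by rw [Finset.card_union_of_disjoint hYZ, card_finIco, card_finIco]; omega)
  have hIc : (Y ∪ Z).card = N + 1 := by
    rw [Finset.card_union_of_disjoint hYZ, card_finIco, card_finIco]; omega
  have hcard : (I' \ (Y ∪ Z)).card = ((Y ∪ Z) \ I').card :=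
    Finset.card_sdiff_comm (h2.trans hIc.symm)
  have h5 : ∑ i ∈ I' \ (Y ∪ Z), (w i - e) = ∑ i ∈ (Y ∪ Z) \ I', (w i - e) := by
    simp only [Finset.sum_sub_distrib, Finset.sum_const, hcard, sum_sdiff_eq_sum_sdiff h4]
  have hK : ∀ i ∈ I' \ (Y ∪ Z), i = l ∨ 2 * n + 1 ≤ (i : ℕ) := by
    intro i hi
    rw [Finset.mem_sdiff] at hi
    have := h1 hi.1
    have h6 := hi.2
    simp only [hY, hZ, hJ, Finset.mem_union, mem_finIco] at this h6
    rw [Fin.ext_iff]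
    simp only [hl]
    omega
  have hsub : (Y ∪ Z) \ I' ⊆ Z := by
    intro a ha
    rw [Finset.mem_sdiff, Finset.mem_union] at ha
    by_contra haZ
    have haY := ha.1.resolve_right haZ
    rw [hY, mem_finIco] at haY
    have h6 : ∑ i ∈ (Y ∪ Z) \ I', (w i - e) ≤ w a - e := by
      have hmem : a ∈ (Y ∪ Z) \ I' := by
        rw [Finset.mem_sdiff, Finset.mem_union]; exact ha
      rw [← Finset.add_sum_erase _ _ hmem]
      have : ∑ i ∈ ((Y ∪ Z) \ I').erase a, (w i - e) ≤ 0 := by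
        apply Finset.sum_nonpos
        intro i hi
        have hi' := (Finset.mem_sdiff.1 (Finset.mem_erase.1 hi).2).1
        rw [Finset.mem_union] at hi'
        rw [sub_nonpos]
        rcases hi' with hi' | hi'
        · rw [hY, mem_finIco] at hi'
          exact hle i (by omega)
        · rw [hZ, mem_finIco] at hi'
          exact (hzero i hi'.1 (by omega)).le
      exact add_le_of_nonpos_right this
    have h7 : w l - e ≤ ∑ i ∈ I' \ (Y ∪ Z), (w i - e) := by
      by_cases hlK : l ∈ I' \ (Y ∪ Z)
      · rw [← Finset.add_sum_erase _ _ hlK]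
        apply le_add_of_nonneg_right
        apply Finset.sum_nonneg
        intro i hi
        rw [Finset.mem_erase] at hi
        exact sub_nonneg.2 (hge i (by have := (hK i hi.2).resolve_left hi.1; omega))
      · refine (sub_nonpos.2 hll.le).trans ?_
        apply Finset.sum_nonneg
        intro i hi
        have : i ≠ l := by rintro rfl; exact hlK hi
        exact sub_nonneg.2 (hge i (by have := (hK i hi).resolve_left this; omega))
    have h8 := hlt a (by omega)
    have h9 := h7.trans (h5.trans_le h6)
    exact absurd (sub_le_sub_iff_right e |>.1 h9) h8.not_ge
  have h10 : ∑ i ∈ (Y ∪ Z) \ I', (w i - e) = 0 := by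
    apply Finset.sum_eq_zero
    intro i hi
    have := hsub hi
    rw [hZ, mem_finIco] at this
    rw [hzero i this.1 (by omega), sub_self]
  refine ⟨I' \ (Y ∪ Z), ?_, ?_, ?_, ?_⟩
  · rw [Finset.disjoint_left]
    intro i hi hi'
    rcases hK i hi with rfl | h6
    · exact hlE hi'
    · rw [mem_finIco] at hi'
      omega
  · rw [Finset.nonempty_iff_ne_empty, Ne, Finset.sdiff_eq_empty_iff_subset]
    intro h6
    exact h3 (Finset.eq_of_subset_of_card_le h6 (by omega))
  · rw [hcard]
    refine (Finset.card_le_card hsub).trans ?_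
    rw [hZ, card_finIco]; omega
  · rw [h10, Finset.sum_sub_distrib, Finset.sum_const, sub_eq_zero] at h5
    exact h5

/-- Comparing the lowest `N + 1` weights with the highest `n + 1`, and dually for `-w`, makes `w`
constant on the positions from `N` to `q - n - 1` and on those from `n` to `q - N - 1`. If `2 * N +
1 ≤ q`, the two intervals meet and together cover the positions from `n` to `q - n - 1`, at least `n
+ 1` of them. Otherwise they are disjoint, and each has length `q - N - n ≥ (n + 3) / 2`. -/
theorem ExchangeProperty.heavy_or_two_of_monotone {q n N : ℕ} {w : Fin q → Γ}
    (h : ExchangeProperty n N w) (hw : Monotone w) (hn : 1 ≤ n) (hnN : n ≤ N)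
    (hq1 : 3 * n + 1 ≤ q) (hq2 : 2 * N + 1 ≤ q ∨ 2 * N + 3 * n + 3 ≤ 2 * q) :
    HasHeavyClass n N w ∨ (n + 2 ≤ N ∧ HasTwoClasses n w) := by
  have hq3 : n + N + 2 ≤ q := by omega
  have hup : w ⟨q - n - 1, by omega⟩ ≤ w ⟨N, by omega⟩ := by
    refine h.le_of_forall_le (A := finIco 0 (N + 1) (by omega)) (B := finIco (q - n - 1) q le_rfl)
      (disjoint_finIco (by omega)) (by rw [card_finIco]; omega) (by rw [card_finIco]; omega) ?_ ?_
    · intro a ha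
      rw [mem_finIco] at ha
      exact hw (Fin.le_def.2 (by simp only; omega))
    · intro a ha
      rw [mem_finIco] at ha
      exact hw (Fin.le_def.2 (by simp only; omega))
  have hdown : w ⟨q - N - 1, by omega⟩ ≤ w ⟨n, by omega⟩ := by
    rw [← neg_le_neg_iff]
    refine h.neg.le_of_forall_le (A := finIco (q - N - 1) q le_rfl)
      (B := finIco 0 (n + 1) (by omega)) (disjoint_finIco (by omega)).symm
      (by rw [card_finIco]; omega) (by rw [card_finIco]; omega) ?_ ?_
    · intro a ha
      rw [mem_finIco] at ha
      exact neg_le_neg (hw (Fin.le_def.2 (by simp only; omega)))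
    · intro a ha
      rw [mem_finIco] at ha
      exact neg_le_neg (hw (Fin.le_def.2 (by simp only; omega)))
  have hX : ∀ j : Fin q, n ≤ (j : ℕ) → (j : ℕ) ≤ q - N - 1 → w j = w ⟨n, by omega⟩ := fun j h1 h2 =>
    le_antisymm ((hw (Fin.le_def.2 h2)).trans hdown) (hw (Fin.le_def.2 h1))
  have hY : ∀ j : Fin q, N ≤ (j : ℕ) → (j : ℕ) ≤ q - n - 1 → w j = w ⟨N, by omega⟩ := fun j h1 h2 =>
    le_antisymm ((hw (Fin.le_def.2 h2)).trans hup) (hw (Fin.le_def.2 h1))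
  by_cases hc : 2 * N + 1 ≤ q
  · left
    have hNn : w ⟨N, by omega⟩ = w ⟨n, by omega⟩ := hX _ hnN (by simp only; omega)
    have hall : ∀ j : Fin q, n ≤ (j : ℕ) → (j : ℕ) ≤ q - n - 1 → w j = w ⟨n, by omega⟩ := by
      intro j h1 h2
      rcases le_total (j : ℕ) (q - N - 1) with h3 | h3
      · exact hX j h1 h3
      · rw [hY j (by omega) h2, hNn]
    refine ⟨finIco n (2 * n + 1) (by omega), w ⟨n, by omega⟩, by rw [card_finIco]; omega, ?_, ?_⟩
    · intro j hj
      rw [mem_finIco] at hj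
      exact hall j hj.1 (by omega)
    · by_cases hq4 : 3 * n + 1 < q
      · left
        refine ⟨⟨2 * n + 1, by omega⟩, by rw [mem_finIco]; simp, hall _ ?_ ?_⟩
        · simp only; omega
        · simp only; omega
      · obtain rfl : q = 3 * n + 1 := by omega
        by_contra! hcon
        obtain ⟨hc1, hc2, hc3⟩ := hcon
        obtain ⟨K, hK1, hK2, hK3, hK4⟩ := h.exists_sum_eq_of_monotone hw hn hnN (by omega)
          (e := w ⟨n, by omega⟩) (fun j hj => by
            rw [mem_finIco] at hj
            exact hall j hj.1 (by omega)) hc1 hc2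
        exact hc3 K hK1 hK2 hK3 (by omega) hK4
  · right
    refine ⟨by omega, finIco n (n + (n + 3) / 2) (by omega),
      finIco N (N + (n + 3 - (n + 3) / 2)) (by omega), disjoint_finIco (by omega), ?_, ?_, ?_,
      ⟨w ⟨n, by omega⟩, ?_⟩, ⟨w ⟨N, by omega⟩, ?_⟩⟩
    · rw [← Finset.card_pos, card_finIco]; omega
    · rw [← Finset.card_pos, card_finIco]; omega
    · rw [card_finIco, card_finIco]; omega
    · intro j hj
      rw [mem_finIco] at hj
      exact hX j hj.1 (by omega)
    · intro j hj
      rw [mem_finIco] at hj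
      exact hY j hj.1 (by omega)

theorem ExchangeProperty.heavy_or_two {q n N : ℕ} {w : Fin q → Γ}
    (h : ExchangeProperty n N w) (hn : 1 ≤ n) (hnN : n ≤ N)
    (hq1 : 3 * n + 1 ≤ q) (hq2 : 2 * N + 1 ≤ q ∨ 2 * N + 3 * n + 3 ≤ 2 * q) :
    HasHeavyClass n N w ∨ (n + 2 ≤ N ∧ HasTwoClasses n w) := by
  set σ := Tuple.sort w
  have hmap : ∀ {E : Finset (Fin q)} {t : Fin q}, t ∉ E → σ t ∉ E.map σ.toEmbedding := by
    intro E t ht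
    simpa using ht
  rcases (h.comp_perm σ).heavy_or_two_of_monotone (Tuple.monotone_sort w) hn hnN hq1 hq2 with
    ⟨E, e, hE, he, hcases⟩ | ⟨hN, X, Y, hXY, hX, hY, hc, ⟨c, hcX⟩, ⟨d, hdY⟩⟩
  · refine Or.inl ⟨E.map σ.toEmbedding, e, by simpa using hE, ?_, ?_⟩
    · intro j hj
      obtain ⟨i, hi, rfl⟩ := Finset.mem_map.1 hj
      exact he i hi
    · rcases hcases with ⟨t, ht, hte⟩ | ⟨s, hs, t, ht, hst, hw⟩ | ⟨K, hK1, hK2, hK3, hK4, hK5⟩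
      · exact Or.inl ⟨σ t, hmap ht, hte⟩
      · exact Or.inr (Or.inl ⟨σ s, hmap hs, σ t, hmap ht, σ.injective.ne hst, hw⟩)
      · refine Or.inr (Or.inr ⟨K.map σ.toEmbedding, (Finset.disjoint_map _).2 hK1, by simpa using hK2,
          by simpa using hK3, by simpa using hK4, ?_⟩)
        rw [Finset.sum_map, Finset.card_map]
        exact hK5
  · refine Or.inr ⟨hN, X.map σ.toEmbedding, Y.map σ.toEmbedding, (Finset.disjoint_map _).2 hXY,
      by simpa using hX, by simpa using hY, by simpa using hc, ⟨c, ?_⟩, ⟨d, ?_⟩⟩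
    · intro j hj
      obtain ⟨i, hi, rfl⟩ := Finset.mem_map.1 hj
      exact hcX i hi
    · intro j hj
      obtain ⟨i, hi, rfl⟩ := Finset.mem_map.1 hj
      exact hdY i hi

end Combinatorics

/-! ### Nonvanishing loci along meromorphic maps -/

section Locus

/-- The nonvanishing locus of a homogeneous function `Φ` along a meromorphic map. -/
def MeromorphicMap.locus {m n : ℕ} (f : MeromorphicMap m n) (Φ : (Fin (n + 1) → ℂ) → ℂ) :
    Set (Fin m → ℂ) :=
  {w | ∃ h : w ∈ f.indetᶜ, Φ (f.toFun ⟨w, h⟩).rep ≠ 0}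

/-- `Φ` is an analytic homogeneous function of positive degree. -/
structure IsHomogeneousFun {n : ℕ} (Φ : (Fin (n + 1) → ℂ) → ℂ) : Prop where
  analytic : AnalyticOnNhd ℂ Φ Set.univ
  smul : ∃ d : ℕ, d ≠ 0 ∧ ∀ (c : ℂ) x, Φ (c • x) = c ^ d * Φ x

theorem isHomogeneousFun_linear {n : ℕ} (ℓ : Module.Dual ℂ (Fin (n + 1) → ℂ)) :
    IsHomogeneousFun (fun x => ℓ x) :=
  ⟨fun x _ => (LinearMap.toContinuousLinearMap ℓ).analyticAt x, 1, one_ne_zero, by simp⟩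

theorem IsHomogeneousFun.ne_zero_iff {m n : ℕ} {Φ : (Fin (n + 1) → ℂ) → ℂ}
    (hΦ : IsHomogeneousFun Φ) {f : MeromorphicMap m n} {U : Set (Fin m → ℂ)}
    {φ : (Fin m → ℂ) → (Fin (n + 1) → ℂ)} (hφ : IsReducedRep f.indet f.toFun U φ)
    {w : Fin m → ℂ} (hw : w ∈ U) : Φ (φ w) ≠ 0 ↔ w ∈ f.locus Φ := by
  obtain ⟨d, hd, hsmul⟩ := hΦ.smul
  have key : ∀ (h : w ∈ f.indetᶜ), Φ (f.toFun ⟨w, h⟩).rep ≠ 0 ↔ Φ (φ w) ≠ 0 := by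
    intro h
    have h0 : φ w ≠ 0 := fun h0 => h ((hφ.zero_iff w hw).1 h0)
    obtain ⟨a, ha⟩ := Projectivization.exists_smul_eq_mk_rep ℂ (φ w) h0
    rw [hφ.eq_mk w hw h h0, ← ha, Units.smul_def, hsmul]
    simp
  constructor
  · intro h
    have hwI : w ∈ f.indetᶜ := by
      intro hI
      rw [(hφ.zero_iff w hw).2 hI] at h
      apply h
      have := hsmul 0 0
      rwa [smul_zero, zero_pow hd, zero_mul] at this
    exact ⟨hwI, (key hwI).2 h⟩
  · rintro ⟨hwI, h⟩
    exact (key hwI).1 h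

theorem IsHomogeneousFun.isOpen_locus {m n : ℕ} {Φ : (Fin (n + 1) → ℂ) → ℂ}
    (hΦ : IsHomogeneousFun Φ) (f : MeromorphicMap m n) : IsOpen (f.locus Φ) := by
  rw [isOpen_iff_mem_nhds]
  intro z hz
  obtain ⟨U, hU, hzU, φ, hφ⟩ := f.exists_rep z
  have hc : ContinuousAt (fun w => Φ (φ w)) z :=
    ((hΦ.analytic _ (Set.mem_univ _)).comp (hφ.holomorphic z hzU)).continuousAt
  filter_upwards [hU.mem_nhds hzU, hc.eventually_ne ((hΦ.ne_zero_iff hφ hzU).2 hz)] with w hw hw0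
  exact (hΦ.ne_zero_iff hφ hw).1 hw0

/-- Representations are only local, so the identity theorem is applied on balls: it shows that the
interior of the complement of the locus is closed as well as open. -/
theorem IsHomogeneousFun.dense_locus {m n : ℕ} {Φ : (Fin (n + 1) → ℂ) → ℂ}
    (hΦ : IsHomogeneousFun Φ) (f : MeromorphicMap m n) (hne : (f.locus Φ).Nonempty) :
    Dense (f.locus Φ) := by
  set W := interior (f.locus Φ)ᶜ with hW
  have hclopen : IsClopen W := by
    refine ⟨?_, isOpen_interior⟩
    rw [← closure_subset_iff_isClosed]
    intro z hz
    obtain ⟨U, hU, hzU, φ, hφ⟩ := f.exists_rep z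
    obtain ⟨ε, hε, hball⟩ := Metric.isOpen_iff.1 hU z hzU
    obtain ⟨z', hz', hz'W⟩ := mem_closure_iff.1 hz _ Metric.isOpen_ball (Metric.mem_ball_self hε)
    have han : AnalyticOnNhd ℂ (fun w => Φ (φ w)) (Metric.ball z ε) := fun w hw =>
      (hΦ.analytic _ (Set.mem_univ _)).comp (hφ.holomorphic w (hball hw))
    have hev : (fun w => Φ (φ w)) =ᶠ[nhds z'] 0 := by
      filter_upwards [isOpen_interior.mem_nhds hz'W, Metric.isOpen_ball.mem_nhds hz'] with w hw hwb
      by_contra h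
      exact interior_subset hw ((hΦ.ne_zero_iff hφ (hball hwb)).1 h)
    have hzero := han.eqOn_zero_of_preconnected_of_eventuallyEq_zero
      (convex_ball z ε).isPreconnected hz' hev
    rw [hW, mem_interior]
    refine ⟨Metric.ball z ε, fun w hw hwl => ?_, Metric.isOpen_ball, Metric.mem_ball_self hε⟩
    exact (hΦ.ne_zero_iff hφ (hball hw)).2 hwl (hzero hw)
  rw [← compl_compl (f.locus Φ), ← interior_eq_empty_iff_dense_compl]
  rcases isClopen_iff.1 hclopen with h | h
  · exact h
  · exfalso
    obtain ⟨z, hz⟩ := hne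
    have : z ∈ W := h ▸ Set.mem_univ z
    exact interior_subset this hz

theorem locus_nonempty_of_not_subset {m n : ℕ} {f : MeromorphicMap m n}
    {Φ : (Fin (n + 1) → ℂ) → ℂ} (h : ¬ f.image ⊆ {x | Φ x.rep = 0}) : (f.locus Φ).Nonempty := by
  obtain ⟨x, ⟨⟨w, hw⟩, rfl⟩, hx⟩ := Set.not_subset.1 h
  exact ⟨w, hw, hx⟩

theorem eq_of_eventually_eq_on_dense {X : Type*} [TopologicalSpace X] {Ω : Set X} (hΩ : Dense Ω)
    {S T : X → ℂ} {z : X} (hS : ContinuousAt S z) (hT : ContinuousAt T z)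
    (h : ∀ᶠ w in nhds z, w ∈ Ω → S w = T w) : S z = T z := by
  have : (nhdsWithin z Ω).NeBot := mem_closure_iff_nhdsWithin_neBot.1 (hΩ z)
  have h1 : S =ᶠ[nhdsWithin z Ω] T := by
    rw [Filter.EventuallyEq, eventually_nhdsWithin_iff]
    exact h
  exact tendsto_nhds_unique ((hS.mono_left nhdsWithin_le_nhds).congr' h1)
    (hT.mono_left nhdsWithin_le_nhds)

end Locus

/-! ### The quotients as global units -/

section Ratio

variable {m n N q : ℕ}

/-- The functions `R j` are, up to a common local factor, the quotients `(f, H j) / (g, H' j)`. -/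
structure IsRatioFamily (f : MeromorphicMap m n) (H : Fin q → Hyperplane n)
    (g : MeromorphicMap m N) (H' : Fin q → Hyperplane N) (R : Fin q → (Fin m → ℂ) → ℂ) : Prop where
  analytic : ∀ j, AnalyticOnNhd ℂ (R j) Set.univ
  ne_zero : ∀ j z, R j z ≠ 0
  eq_mul : ∀ z φ ψ, f.IsRepAt z φ → g.IsRepAt z ψ → ∃ u : (Fin m → ℂ) → ℂ, u z ≠ 0 ∧
    ContinuousAt u z ∧ ∀ᶠ w in nhds z, ∀ j, (H j).rep (φ w) = u w * R j w * (H' j).rep (ψ w)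

theorem MeromorphicMap.exists_isRepAt (f : MeromorphicMap m n) (z : Fin m → ℂ) :
    ∃ φ, f.IsRepAt z φ := by
  obtain ⟨U, hU, hz, φ, hφ⟩ := f.exists_rep z
  exact ⟨φ, U, hU, hz, hφ⟩

theorem MeromorphicMap.IsRepAt.eventually_mem {f : MeromorphicMap m n} {z : Fin m → ℂ}
    {φ : (Fin m → ℂ) → (Fin (n + 1) → ℂ)} (h : f.IsRepAt z φ) :
    ∀ᶠ w in nhds z, f.IsRepAt w φ := by
  obtain ⟨U, hU, hz, hφ⟩ := h
  filter_upwards [hU.mem_nhds hz] with w hw using ⟨U, hU, hw, hφ⟩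

theorem MeromorphicMap.IsRepAt.ne_zero_iff {f : MeromorphicMap m n} {z : Fin m → ℂ}
    {φ : (Fin m → ℂ) → (Fin (n + 1) → ℂ)} (h : f.IsRepAt z φ) {Φ : (Fin (n + 1) → ℂ) → ℂ}
    (hΦ : IsHomogeneousFun Φ) : Φ (φ z) ≠ 0 ↔ z ∈ f.locus Φ := by
  obtain ⟨U, hU, hz, hφ⟩ := h
  exact hΦ.ne_zero_iff hφ hz

/-- Two reduced representations of a meromorphic map are proportional at each point. -/
theorem MeromorphicMap.IsRepAt.exists_smul {f : MeromorphicMap m n} {z : Fin m → ℂ}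
    {φ φ' : (Fin m → ℂ) → (Fin (n + 1) → ℂ)} (h : f.IsRepAt z φ) (h' : f.IsRepAt z φ') :
    ∃ a : ℂ, a ≠ 0 ∧ φ' z = a • φ z := by
  obtain ⟨U, hU, hz, hφ⟩ := h
  obtain ⟨U', hU', hz', hφ'⟩ := h'
  by_cases hI : z ∈ f.indet
  · exact ⟨1, one_ne_zero, by rw [(hφ.zero_iff z hz).2 hI, (hφ'.zero_iff z hz').2 hI, smul_zero]⟩
  · have h0 : φ z ≠ 0 := fun h0 => hI ((hφ.zero_iff z hz).1 h0)
    have h0' : φ' z ≠ 0 := fun h0 => hI ((hφ'.zero_iff z hz').1 h0)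
    have := (hφ'.eq_mk z hz' hI h0').symm.trans (hφ.eq_mk z hz hI h0)
    obtain ⟨a, ha⟩ := (Projectivization.mk_eq_mk_iff ℂ _ _ h0' h0).1 this
    exact ⟨a, a.ne_zero, ha.symm⟩

/-- Changing the local representations multiplies all the local factors `u j` by the same quantity,
so `u j / u i₀` is globally well defined. The cancellation is made on the dense set where no `(g, H'
j)` vanishes and is extended by continuity. -/
theorem exists_ratioFamily {f : MeromorphicMap m n} {H : Fin q → Hyperplane n}
    {g : MeromorphicMap m N} {H' : Fin q → Hyperplane N}
    (hg : ∀ j, ¬ g.image ⊆ (H' j).carrier)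
    (hfg : ∀ j, f.SamePullbackDivisor (H j) g (H' j)) (i₀ : Fin q) :
    ∃ R, IsRatioFamily f H g H' R := by
  choose φ hφ using f.exists_isRepAt
  choose ψ hψ using g.exists_isRepAt
  choose u hua hu0 hu using fun z j => hfg j z (φ z) (ψ z) (hφ z) (hψ z)
  set Ω : Set (Fin m → ℂ) := ⋂ j, g.locus (fun x => (H' j).rep x) with hΩ
  have hΩd : Dense Ω := dense_iInter_of_isOpen
    (fun j => (isHomogeneousFun_linear _).isOpen_locus g)
    fun j => (isHomogeneousFun_linear _).dense_locus g (locus_nonempty_of_not_subset (hg j))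
  have hmemΩ : ∀ {z ψ'} j, z ∈ Ω → g.IsRepAt z ψ' → (H' j).rep (ψ' z) ≠ 0 := fun j hz hψ' =>
    (hψ'.ne_zero_iff (isHomogeneousFun_linear (H' j).rep)).2 (Set.mem_iInter.1 hz j)
  -- the quotients do not depend on the chosen representations
  have hunique : ∀ (z : Fin m → ℂ) (φ' : (Fin m → ℂ) → (Fin (n + 1) → ℂ)) (ψ' : (Fin m → ℂ) → (Fin (N + 1) → ℂ))
      (u' : Fin q → (Fin m → ℂ) → ℂ), f.IsRepAt z φ' → g.IsRepAt z ψ' →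
      (∀ j, ContinuousAt (u' j) z) → (∀ j, u' j z ≠ 0) →
      (∀ j, ∀ᶠ w in nhds z, (H j).rep (φ' w) = u' j w * (H' j).rep (ψ' w)) →
      ∀ j, u z j z / u z i₀ z = u' j z / u' i₀ z := by
    intro z φ' ψ' u' hφ' hψ' hu'c hu'0 hu' j
    apply eq_of_eventually_eq_on_dense (S := fun w => u z j w / u z i₀ w)
      (T := fun w => u' j w / u' i₀ w) hΩd
    · exact (hua z j).continuousAt.div (hua z i₀).continuousAt (hu0 z i₀)
    · exact (hu'c j).div (hu'c i₀) (hu'0 i₀)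
    · filter_upwards [hu z j, hu z i₀, hu' j, hu' i₀, (hφ z).eventually_mem, (hψ z).eventually_mem,
        hφ'.eventually_mem, hψ'.eventually_mem, (hua z i₀).continuousAt.eventually_ne (hu0 z i₀),
        (hu'c i₀).eventually_ne (hu'0 i₀)] with w e1 e2 e3 e4 r1 r2 r3 r4 n1 n2 hw
      obtain ⟨a, ha, hφa⟩ := r1.exists_smul r3
      obtain ⟨b, hb, hψb⟩ := r2.exists_smul r4
      have k1 := hmemΩ j hw r2
      have k2 := hmemΩ i₀ hw r2
      rw [hφa, hψb, map_smul, map_smul, smul_eq_mul, smul_eq_mul] at e3 e4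
      rw [e1] at e3
      rw [e2] at e4
      have e3' : a * u z j w = u' j w * b := by
        apply mul_right_cancel₀ k1; linear_combination e3
      have e4' : a * u z i₀ w = u' i₀ w * b := by
        apply mul_right_cancel₀ k2; linear_combination e4
      rw [div_eq_div_iff n1 n2]
      apply mul_left_cancel₀ (mul_ne_zero ha hb)
      linear_combination b * u' i₀ w * e3' - b * u' j w * e4'
  refine ⟨fun j z => u z j z / u z i₀ z, ?_, fun j z => div_ne_zero (hu0 z j) (hu0 z i₀), ?_⟩
  · intro j z _
    apply ((hua z j).div (hua z i₀) (hu0 z i₀)).congr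
    have hev : ∀ᶠ w in nhds z, ∀ j, ∀ᶠ y in nhds w,
        (H j).rep (φ z y) = u z j y * (H' j).rep (ψ z y) :=
      Filter.eventually_all.2 fun j => (hu z j).eventually_nhds
    filter_upwards [hev, (hφ z).eventually_mem, (hψ z).eventually_mem,
      Filter.eventually_all.2 fun j => (hua z j).eventually_analyticAt,
      Filter.eventually_all.2 fun j => (hua z j).continuousAt.eventually_ne (hu0 z j)]
      with w e1 r1 r2 a1 n1
    exact (hunique w _ _ _ r1 r2 (fun j => (a1 j).continuousAt) n1 e1 j).symm
  · intro z φ' ψ' hφ' hψ'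
    choose u' hu'a hu'0 hu' using fun j => hfg j z φ' ψ' hφ' hψ'
    refine ⟨u' i₀, hu'0 i₀, (hu'a i₀).continuousAt, ?_⟩
    have hev : ∀ᶠ w in nhds z, ∀ j, ∀ᶠ y in nhds w,
        (H j).rep (φ' y) = u' j y * (H' j).rep (ψ' y) :=
      Filter.eventually_all.2 fun j => (hu' j).eventually_nhds
    filter_upwards [hev, hφ'.eventually_mem, hψ'.eventually_mem,
      Filter.eventually_all.2 fun j => (hu'a j).eventually_analyticAt,
      Filter.eventually_all.2 fun j => (hu'a j).continuousAt.eventually_ne (hu'0 j)]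
      with w e1 r1 r2 a1 n1 j
    rw [hunique w _ _ _ r1 r2 (fun j => (a1 j).continuousAt) n1 e1 j, mul_div_cancel₀ _ (n1 i₀)]
    exact (e1 j).self_of_nhds

end Ratio

/-! ### Linear algebra of general position -/

section GeneralPosition

variable {n q : ℕ}

theorem InGeneralPosition.linearIndependent {H : Fin q → Hyperplane n} (hH : InGeneralPosition H)
    {s : Finset (Fin q)} (hs : s.card ≤ n + 1) : LinearIndependent ℂ fun i : s => (H i).rep :=
  Projectivization.independent_iff.1 (hH s hs)

/-- The linear forms of a family in general position take arbitrary prescribed values. -/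
theorem InGeneralPosition.exists_eq {H : Fin q → Hyperplane n} (hH : InGeneralPosition H)
    {s : Finset (Fin q)} (hs : s.card ≤ n + 1) (c : Fin q → ℂ) :
    ∃ x, ∀ j ∈ s, (H j).rep x = c j := by
  set Φ : (Fin (n + 1) → ℂ) →ₗ[ℂ] (s → ℂ) := LinearMap.pi fun i => (H i).rep with hΦ
  have hsurj : LinearMap.range Φ = ⊤ := by
    by_contra hne
    obtain ⟨φ, hφ0, hφ⟩ := Submodule.exists_le_ker_of_lt_top _ (lt_top_iff_ne_top.2 hne)
    apply hφ0
    have hc : ∀ x, φ x = ∑ j, x j * φ (Pi.single j 1) := by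
      intro x
      conv_lhs => rw [pi_eq_sum_univ' x]
      simp [map_sum]
    have hzero := Fintype.linearIndependent_iff.1 (hH.linearIndependent hs)
      (fun j => φ (Pi.single j 1)) (by
        refine LinearMap.ext fun x => ?_
        have h1 : φ (Φ x) = 0 := hφ ⟨_, rfl⟩
        rw [hc] at h1
        rw [LinearMap.sum_apply, LinearMap.zero_apply, ← h1]
        exact Finset.sum_congr rfl fun j _ => mul_comm _ _)
    ext j
    simp [hzero]
  obtain ⟨x, hx⟩ := LinearMap.range_eq_top.1 hsurj fun j => c j
  exact ⟨x, fun j hj => congrFun hx ⟨j, hj⟩⟩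

theorem InGeneralPosition.eq_zero {H : Fin q → Hyperplane n} (hH : InGeneralPosition H)
    {s : Finset (Fin q)} (hs : s.card = n + 1) {x : Fin (n + 1) → ℂ}
    (hx : ∀ j ∈ s, (H j).rep x = 0) : x = 0 := by
  have hli := hH.linearIndependent hs.le
  have hspan : Submodule.span ℂ (Set.range fun i : s => (H i).rep) = ⊤ :=
    hli.span_eq_top_of_card_eq_finrank' (by simp [hs, Subspace.dual_finrank_eq])
  rw [← Module.forall_dual_apply_eq_zero_iff ℂ]
  intro φ
  have hφ : φ ∈ Submodule.span ℂ (Set.range fun i : s => (H i).rep) := hspan ▸ Submodule.mem_top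
  induction hφ using Submodule.span_induction with
  | mem φ h =>
    obtain ⟨j, rfl⟩ := h
    exact hx j j.2
  | zero => rfl
  | add a b _ _ ha hb => rw [LinearMap.add_apply, ha, hb, add_zero]
  | smul c a _ ha => rw [LinearMap.smul_apply, ha, smul_zero]

theorem exists_ne_zero_of_card_lt {ι : Type*} {k : ℕ} (s : Finset ι) (hs : s.card < k)
    (ℓ : ι → Module.Dual ℂ (Fin k → ℂ)) : ∃ x, x ≠ 0 ∧ ∀ j ∈ s, ℓ j x = 0 := by
  set Φ : (Fin k → ℂ) →ₗ[ℂ] (s → ℂ) := LinearMap.pi fun i => ℓ i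
  have h1 : LinearMap.ker Φ ≠ ⊥ := LinearMap.ker_ne_bot_of_finrank_lt (by simpa using hs)
  obtain ⟨x, hx, hx0⟩ := Submodule.exists_mem_ne_zero_of_ne_bot h1
  exact ⟨x, hx0, fun j hj => congrFun (LinearMap.mem_ker.1 hx) ⟨j, hj⟩⟩

end GeneralPosition

/-! ### The determinant relation and the exchange property -/

section Determinant

variable {n N q : ℕ}

/-- The row `(a, b)` of coefficients of a pair of linear forms. -/
def coeffRow (a : Module.Dual ℂ (Fin (n + 1) → ℂ)) (b : Module.Dual ℂ (Fin (N + 1) → ℂ)) :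
    Fin (n + 1) ⊕ Fin (N + 1) → ℂ :=
  Sum.elim (fun k => a (Pi.single k 1)) fun k => b (Pi.single k 1)

theorem coeffRow_dotProduct (a : Module.Dual ℂ (Fin (n + 1) → ℂ))
    (b : Module.Dual ℂ (Fin (N + 1) → ℂ)) (x : Fin (n + 1) → ℂ) (y : Fin (N + 1) → ℂ) :
    coeffRow a b ⬝ᵥ Sum.elim x y = a x + b y := by
  have h : ∀ {k : ℕ} (c : Module.Dual ℂ (Fin (k + 1) → ℂ)) (x : Fin (k + 1) → ℂ),
      ∑ i, c (Pi.single i 1) * x i = c x := by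
    intro k c x
    conv_rhs => rw [pi_eq_sum_univ' x]
    simp [map_sum, mul_comm]
  simp only [dotProduct, coeffRow, Fintype.sum_sum_type, Sum.elim_inl, Sum.elim_inr, h]

theorem coeffRow_add_smul (a : Module.Dual ℂ (Fin (n + 1) → ℂ))
    (b : Module.Dual ℂ (Fin (N + 1) → ℂ)) (r : ℂ) :
    coeffRow a (r • b) = coeffRow a 0 + r • coeffRow (0 : Module.Dual ℂ (Fin (n + 1) → ℂ)) b := by
  funext k
  rcases k with k | k <;> simp [coeffRow]

/-- The determinant with rows `(a_j, 0)` for `j ∈ s` and `(0, b_j)` for `j ∉ s` does not vanish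
precisely if `s` has `n + 1` elements. -/
theorem det_piecewise_ne_zero_iff {H : Fin q → Hyperplane n} {H' : Fin q → Hyperplane N}
    (hH : InGeneralPosition H) (hH' : InGeneralPosition H')
    (e : Fin (n + 1) ⊕ Fin (N + 1) → Fin q) (he : Function.Injective e)
    (s : Finset (Fin (n + 1) ⊕ Fin (N + 1))) :
    Matrix.det (Matrix.of <| s.piecewise
      (fun i => coeffRow (H (e i)).rep (0 : Module.Dual ℂ (Fin (N + 1) → ℂ)))
      (fun i => coeffRow (0 : Module.Dual ℂ (Fin (n + 1) → ℂ)) (H' (e i)).rep)) ≠ 0 ↔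
      s.card = n + 1 := by
  set M : Matrix (Fin (n + 1) ⊕ Fin (N + 1)) (Fin (n + 1) ⊕ Fin (N + 1)) ℂ := Matrix.of <| s.piecewise
      (fun i => coeffRow (H (e i)).rep (0 : Module.Dual ℂ (Fin (N + 1) → ℂ)))
      (fun i => coeffRow (0 : Module.Dual ℂ (Fin (n + 1) → ℂ)) (H' (e i)).rep) with hM
  -- Rows in `s` see only `x`, the others only `y`. If `s` has the wrong size, one block has fewer
  -- equations than unknowns; if it has `n + 1` elements, general position kills both `x` and `y`.
  have hmul : ∀ x y i, M.mulVec (Sum.elim x y) i =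
      if i ∈ s then (H (e i)).rep x else (H' (e i)).rep y := by
    intro x y i
    change M i ⬝ᵥ Sum.elim x y = _
    split_ifs with hi
    · have h1 : M i = coeffRow (H (e i)).rep 0 := by funext k; simp [hM, hi]
      rw [h1, coeffRow_dotProduct, LinearMap.zero_apply, add_zero]
    · have h1 : M i = coeffRow 0 (H' (e i)).rep := by funext k; simp [hM, hi]
      rw [h1, coeffRow_dotProduct, LinearMap.zero_apply, zero_add]
  have hcompl : sᶜ.card = n + 1 + (N + 1) - s.card := by
    rw [Finset.card_compl]; simp
  have hsle : s.card ≤ n + 1 + (N + 1) := by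
    have := Finset.card_le_univ s; simpa using this
  rw [Ne, ← Matrix.exists_mulVec_eq_zero_iff]
  constructor
  · intro h
    by_contra hs
    apply h
    rcases Nat.lt_or_gt_of_ne hs with hlt | hgt
    · obtain ⟨x, hx0, hx⟩ := exists_ne_zero_of_card_lt s hlt fun i => (H (e i)).rep
      refine ⟨Sum.elim x 0, fun h0 => hx0 (by simpa using congrArg (· ∘ Sum.inl) h0), ?_⟩
      funext i
      rw [hmul]
      split_ifs with hi
      · exact hx i hi
      · simp
    · obtain ⟨y, hy0, hy⟩ := exists_ne_zero_of_card_lt sᶜ (by omega : sᶜ.card < N + 1)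
        fun i => (H' (e i)).rep
      refine ⟨Sum.elim 0 y, fun h0 => hy0 (by simpa using congrArg (· ∘ Sum.inr) h0), ?_⟩
      funext i
      rw [hmul]
      split_ifs with hi
      · simp
      · exact hy i (by simpa using hi)
  · rintro hs ⟨v, hv0, hv⟩
    obtain ⟨x, y, rfl⟩ : ∃ x y, v = Sum.elim x y :=
      ⟨v ∘ Sum.inl, v ∘ Sum.inr, (Sum.elim_comp_inl_inr v).symm⟩
    have hi := fun i => (hmul x y i).symm.trans (congrFun hv i)
    have hx : x = 0 := by
      apply hH.eq_zero (s := s.map ⟨e, he⟩) (by rw [Finset.card_map, hs])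
      intro j hj
      obtain ⟨i, his, rfl⟩ := Finset.mem_map.1 hj
      have := hi i
      rwa [if_pos his] at this
    have hy : y = 0 := by
      apply hH'.eq_zero (s := sᶜ.map ⟨e, he⟩) (by rw [Finset.card_map]; omega)
      intro j hj
      obtain ⟨i, his, rfl⟩ := Finset.mem_map.1 hj
      have := hi i
      rwa [if_neg (by simpa using his)] at this
    apply hv0
    rw [hx, hy]
    funext k
    rcases k with k | k <;> rfl

theorem det_add_smul_eq_sum {ι : Type*} [Fintype ι] [DecidableEq ι] (A B : ι → ι → ℂ) (r : ι → ℂ) :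
    Matrix.det (Matrix.of fun i => A i + r i • B i) =
      ∑ s : Finset ι, (∏ i ∈ sᶜ, r i) * Matrix.det (Matrix.of (s.piecewise A B)) := by
  have h1 := (Matrix.detRowAlternating (R := ℂ) (n := ι)).toMultilinearMap.map_add_univ A
    fun i => r i • B i
  refine h1.trans (Finset.sum_congr rfl fun s _ => ?_)
  have h2 : s.piecewise A (fun i => r i • B i) =
      fun i => (sᶜ.piecewise r 1) i • s.piecewise A B i := by
    funext i
    by_cases hi : i ∈ s <;> simp [Finset.piecewise, hi]
  rw [h2, MultilinearMap.map_smul_univ]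
  have h3 : ∏ i, (sᶜ.piecewise r 1) i = ∏ i ∈ sᶜ, r i := by
    rw [Finset.prod_piecewise]; simp
  rw [h3, smul_eq_mul]
  rfl

variable {m : ℕ}

/-- The vector `(φ, -u ψ)` lies in the kernel, and it is nonzero where `(g, H' i₀)` does not vanish.
That locus is dense and the determinant is continuous. -/
theorem IsRatioFamily.det_eq_zero {f : MeromorphicMap m n} {H : Fin q → Hyperplane n}
    {g : MeromorphicMap m N} {H' : Fin q → Hyperplane N} {R : Fin q → (Fin m → ℂ) → ℂ}
    (hR : IsRatioFamily f H g H' R) (i₀ : Fin q) (hg : ¬ g.image ⊆ (H' i₀).carrier)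
    (e : Fin (n + 1) ⊕ Fin (N + 1) → Fin q) (z : Fin m → ℂ) :
    Matrix.det (Matrix.of fun i => coeffRow (H (e i)).rep (R (e i) z • (H' (e i)).rep)) = 0 := by
  have hcont : Continuous fun z =>
      Matrix.det (Matrix.of fun i => coeffRow (H (e i)).rep (R (e i) z • (H' (e i)).rep)) := by
    have h1 : ∀ j, Continuous (R j) := fun j => continuousOn_univ.1 (hR.analytic j).continuousOn
    apply Continuous.matrix_det
    apply continuous_matrix
    intro i k
    rcases k with k | k
    · exact continuous_const
    · exact (h1 (e i)).mul continuous_const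
  have hlin := isHomogeneousFun_linear (H' i₀).rep
  have hdense := hlin.dense_locus g (locus_nonempty_of_not_subset hg)
  have hclosed := isClosed_singleton (x := (0 : ℂ)).preimage hcont
  refine hclosed.closure_subset_iff.2 ?_ (hdense z)
  intro w hw
  obtain ⟨φ, hφ⟩ := f.exists_isRepAt w
  obtain ⟨ψ, hψ⟩ := g.exists_isRepAt w
  obtain ⟨u, hu0, -, hu⟩ := hR.eq_mul w φ ψ hφ hψ
  have hψ0 := (hψ.ne_zero_iff hlin).2 hw
  rw [Set.mem_preimage, Set.mem_singleton_iff, ← Matrix.exists_mulVec_eq_zero_iff]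
  refine ⟨Sum.elim (φ w) (-(u w) • ψ w), ?_, ?_⟩
  · intro h0
    have h1 : -(u w) • ψ w = 0 := by simpa using congrArg (· ∘ Sum.inr) h0
    rw [smul_eq_zero, neg_eq_zero] at h1
    rw [h1.resolve_left hu0] at hψ0
    simp at hψ0
  · funext i
    have h1 := hu.self_of_nhds (e i)
    change coeffRow (H (e i)).rep (R (e i) w • (H' (e i)).rep) ⬝ᵥ _ = 0
    rw [coeffRow_dotProduct, h1, map_smul, LinearMap.smul_apply, smul_eq_mul, smul_eq_mul]
    ring

/-- Borel's theorem gives the exchange property of the quotients modulo constants. -/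
theorem IsRatioFamily.exists_exchange {f : MeromorphicMap m n} {H : Fin q → Hyperplane n}
    {g : MeromorphicMap m N} {H' : Fin q → Hyperplane N} {R : Fin q → (Fin m → ℂ) → ℂ}
    (hH : InGeneralPosition H) (hH' : InGeneralPosition H')
    (hR : IsRatioFamily f H g H' R) (hg : ∀ j, ¬ g.image ⊆ (H' j).carrier)
    {J : Finset (Fin q)} (hJ : J.card = n + N + 2) {I : Finset (Fin q)} (hI : I ⊆ J)
    (hIc : I.card = N + 1) :
    ∃ I' ⊆ J, I'.card = N + 1 ∧ I' ≠ I ∧ ∃ c : ℂ, ∀ z, ∏ i ∈ I, R i z = c * ∏ i ∈ I', R i z := by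
  classical
  set ε : Fin (n + 1) ⊕ Fin (N + 1) ≃ J := Fintype.equivOfCardEq (by simp [hJ]; omega) with hε
  set e : Fin (n + 1) ⊕ Fin (N + 1) → Fin q := fun i => ε i with he
  have hinj : Function.Injective e := fun a b h => ε.injective (Subtype.ext h)
  set C : Finset (Fin (n + 1) ⊕ Fin (N + 1)) → ℂ := fun s => Matrix.det (Matrix.of <| s.piecewise
      (fun i => coeffRow (H (e i)).rep (0 : Module.Dual ℂ (Fin (N + 1) → ℂ)))
      (fun i => coeffRow (0 : Module.Dual ℂ (Fin (n + 1) → ℂ)) (H' (e i)).rep)) with hC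
  have hCne : ∀ s, C s ≠ 0 ↔ s.card = n + 1 := fun s => det_piecewise_ne_zero_iff hH hH' e hinj s
  have i₀ : Fin q := e (Sum.inl 0)
  -- Terms with zero coefficient are discarded, since Borel's theorem needs every summand to be
  -- nowhere vanishing.
  have hsum : ∀ z, ∑ s : {s // C s ≠ 0}, C s * ∏ i ∈ (s : Finset _)ᶜ, R (e i) z = 0 := by
    intro z
    have h1 := hR.det_eq_zero i₀ (hg i₀) e z
    simp only [coeffRow_add_smul] at h1
    rw [det_add_smul_eq_sum] at h1
    refine Eq.trans ?_ h1
    rw [← Finset.sum_subtype (Finset.univ.filter fun s => C s ≠ 0) (by simp)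
      (fun s => C s * ∏ i ∈ sᶜ, R (e i) z), Finset.sum_filter_of_ne]
    · exact Finset.sum_congr rfl fun s _ => mul_comm _ _
    · intro s _ h
      exact left_ne_zero_of_mul h
  have hcompl : ∀ s : Finset (Fin (n + 1) ⊕ Fin (N + 1)), sᶜ.card = n + 1 + (N + 1) - s.card := by
    intro s
    rw [Finset.card_compl]; simp
  have hpre : ∃ s : Finset (Fin (n + 1) ⊕ Fin (N + 1)), sᶜ.map ⟨e, hinj⟩ = I := by
    refine ⟨(Finset.univ.filter fun i => e i ∈ I)ᶜ, ?_⟩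
    rw [compl_compl]
    ext j
    simp only [Finset.mem_map, Finset.mem_filter, Finset.mem_univ, true_and,
      Function.Embedding.coeFn_mk]
    constructor
    · rintro ⟨i, hi, rfl⟩
      exact hi
    · intro hj
      refine ⟨ε.symm ⟨j, hI hj⟩, ?_, ?_⟩ <;> simp [he, hj]
  obtain ⟨s, hs⟩ := hpre
  have hsle : s.card ≤ n + 1 + (N + 1) := by
    have := Finset.card_le_univ s; simpa using this
  have hscard : s.card = n + 1 := by
    have h1 := congrArg Finset.card hs
    rw [Finset.card_map, hIc, hcompl] at h1
    omega
  obtain ⟨⟨t, ht⟩, hts, c, hc⟩ := borel_analytic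
    (u := fun (s : {s // C s ≠ 0}) z => C s * ∏ i ∈ (s : Finset _)ᶜ, R (e i) z)
    (fun s => analyticOnNhd_const.mul
      (Finset.analyticOnNhd_fun_prod _ fun i _ => hR.analytic (e i)))
    (fun s z => mul_ne_zero s.2 (Finset.prod_ne_zero_iff.2 fun i _ => hR.ne_zero _ z)) hsum
    ⟨s, (hCne s).2 hscard⟩
  refine ⟨tᶜ.map ⟨e, hinj⟩, ?_, ?_, ?_, c * C t / C s, ?_⟩
  · intro j hj
    obtain ⟨i, -, rfl⟩ := Finset.mem_map.1 hj
    exact (ε i).2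
  · rw [Finset.card_map, hcompl, (hCne t).1 ht]; omega
  · rw [← hs]
    intro h
    apply hts
    apply Subtype.ext
    exact compl_injective (Finset.map_injective _ h)
  · intro z
    have h1 := hc z
    simp only at h1
    have h2 := (hCne s).2 hscard
    rw [← hs, Finset.prod_map, Finset.prod_map]
    simp only [Function.Embedding.coeFn_mk]
    field_simp
    linear_combination h1

end Determinant

/-! ### Weights of the units modulo constants -/

section Weights

/-- The multiplicative relations modulo constants of nowhere vanishing entire functions are
the linear relations of a family in a linearly ordered group. -/
theorem exists_weights {m q : ℕ} {R : Fin q → (Fin m → ℂ) → ℂ} (hR : ∀ j, Continuous (R j))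
    (hR0 : ∀ j z, R j z ≠ 0) :
    ∃ (ρ : ℕ) (w : Fin q → Lex (Fin ρ → ℤ)), ∀ a : Fin q → ℤ,
      ∑ j, a j • w j = 0 ↔ ∃ c : ℂ, ∀ z, ∏ j, R j z ^ a j = c := by
  set α : Fin q → ((Fin m → ℂ) → ℂˣ) := fun j z =>
    Units.mk0 (R j z / R j 0) (div_ne_zero (hR0 j z) (hR0 j 0)) with hα
  obtain ⟨ρ, w, hw⟩ := exists_lex_relations α (by
    intro g hg k hk hgk
    -- No torsion: a continuous function with values in the `k`-th roots of unity is constant, and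
    -- the normalisation at `0` makes the constant `1`.
    have hprop : Continuous (fun z => (g z : ℂ)) ∧ g 0 = 1 := by
      clear hgk
      induction hg using Subgroup.closure_induction with
      | mem g h =>
        obtain ⟨j, rfl⟩ := h
        refine ⟨(hR j).div_const _, Units.ext ?_⟩
        simp [hα, hR0]
      | one => exact ⟨continuous_const, rfl⟩
      | mul a b _ _ ha hb =>
        refine ⟨?_, by rw [Pi.mul_apply, ha.2, hb.2, one_mul]⟩
        simp only [Pi.mul_apply, Units.val_mul]
        exact ha.1.mul hb.1
      | inv a _ ha =>
        refine ⟨?_, by rw [Pi.inv_apply, ha.2, inv_one]⟩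
        simp only [Pi.inv_apply, Units.val_inv_eq_inv_val]
        exact ha.1.inv₀ fun z => (a z).ne_zero
    have hfin : {x : ℂ | x ^ k = 1}.Finite := by
      apply (Polynomial.nthRoots k (1 : ℂ)).toFinset.finite_toSet.subset
      intro x hx
      simpa [Polynomial.mem_nthRoots (Nat.pos_of_ne_zero hk)] using hx
    funext z
    apply Units.ext
    have h1 := isPreconnected_univ.constant_of_mapsTo hfin.isDiscrete hprop.1.continuousOn
      (fun z _ => by
        have := congrArg Units.val (congrFun hgk z)
        simpa using this) (Set.mem_univ z) (Set.mem_univ 0)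
    rw [h1, hprop.2]
    rfl)
  refine ⟨ρ, w, fun a => (hw a).trans ?_⟩
  have hval : ∀ z, (((∏ j, α j ^ a j) z : ℂˣ) : ℂ) = (∏ j, R j z ^ a j) / ∏ j, R j 0 ^ a j := by
    intro z
    simp [hα, Finset.prod_apply, div_zpow, Finset.prod_div_distrib]
  have hne : ∀ z, ∏ j, R j z ^ a j ≠ 0 := fun z =>
    Finset.prod_ne_zero_iff.2 fun j _ => zpow_ne_zero _ (hR0 j z)
  constructor
  · intro h
    refine ⟨∏ j, R j 0 ^ a j, fun z => ?_⟩
    have h1 := hval z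
    rw [h, Pi.one_apply, Units.val_one, eq_div_iff (hne 0), one_mul] at h1
    exact h1.symm
  · rintro ⟨c, hc⟩
    funext z
    apply Units.ext
    rw [hval, hc, hc, Pi.one_apply, Units.val_one, div_self]
    rw [← hc 0]
    exact hne 0

variable {q : ℕ}

/-- The exponent vector of a set of indices. -/
def indicatorExp (I : Finset (Fin q)) : Fin q → ℤ := fun j => if j ∈ I then 1 else 0

theorem sum_indicatorExp_smul {Γ : Type*} [AddCommGroup Γ] (I : Finset (Fin q)) (w : Fin q → Γ) :
    ∑ j, indicatorExp I j • w j = ∑ j ∈ I, w j := by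
  simp [indicatorExp, ite_smul, Finset.sum_ite_mem]

theorem prod_zpow_indicatorExp (I : Finset (Fin q)) (x : Fin q → ℂ) :
    ∏ j, x j ^ indicatorExp I j = ∏ j ∈ I, x j := by
  have : ∀ j, x j ^ indicatorExp I j = if j ∈ I then x j else 1 := by
    intro j
    simp only [indicatorExp]
    split_ifs <;> simp
  simp [this, Finset.prod_ite_mem]

/-- Weights of nowhere vanishing functions modulo constants, in multiplicative form. -/
theorem weights_iff {X : Type*} {Γ : Type*} [AddCommGroup Γ] {R : Fin q → X → ℂ} {w : Fin q → Γ}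
    (hR0 : ∀ j z, R j z ≠ 0)
    (hw : ∀ a : Fin q → ℤ, ∑ j, a j • w j = 0 ↔ ∃ c : ℂ, ∀ z, ∏ j, R j z ^ a j = c)
    (I : Finset (Fin q)) (a : Fin q → ℤ) :
    ∑ j ∈ I, w j = ∑ j, a j • w j ↔
      ∃ c : ℂ, ∀ z, ∏ j ∈ I, R j z = c * ∏ j, R j z ^ a j := by
  have h1 := hw (indicatorExp I - a)
  have h2 : ∀ z, ∏ j, R j z ^ (indicatorExp I - a) j = (∏ j ∈ I, R j z) / ∏ j, R j z ^ a j := by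
    intro z
    rw [← prod_zpow_indicatorExp I, ← Finset.prod_div_distrib]
    exact Finset.prod_congr rfl fun j _ => zpow_sub₀ (hR0 j z) _ _
  have hne : ∀ z, ∏ j, R j z ^ a j ≠ 0 := fun z =>
    Finset.prod_ne_zero_iff.2 fun j _ => zpow_ne_zero _ (hR0 j z)
  simp only [Pi.sub_apply, sub_smul, Finset.sum_sub_distrib, sum_indicatorExp_smul] at h1
  rw [sub_eq_zero] at h1
  rw [h1]
  refine exists_congr fun c => forall_congr' fun z => ?_
  rw [← div_eq_iff (hne z), ← h2]
  rfl

end Weights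

/-! ### From identities along `g` to polynomial identities -/

section Nondegenerate

open MvPolynomial

theorem MvPolynomial.IsHomogeneous.eval_smul {σ : Type*} [Fintype σ] {P : MvPolynomial σ ℂ} {d : ℕ}
    (hP : P.IsHomogeneous d) (c : ℂ) (x : σ → ℂ) : eval (c • x) P = c ^ d * eval x P := by
  rw [eval_eq', eval_eq', Finset.mul_sum]
  apply Finset.sum_congr rfl
  intro s hs
  have h1 : ∑ i, s i = d := by
    have := hP (mem_support_iff.1 hs)
    rw [← this, Finsupp.weight_apply, Finsupp.sum_fintype _ _ (by simp)]
    simp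
  simp only [Pi.smul_apply, smul_eq_mul, mul_pow, Finset.prod_mul_distrib, Finset.prod_pow_eq_pow_sum]
  rw [h1]
  ring

theorem MvPolynomial.IsHomogeneous.isHomogeneousFun {N d : ℕ}
    {P : MvPolynomial (Fin (N + 1)) ℂ} (hP : P.IsHomogeneous d) (hd : d ≠ 0) :
    IsHomogeneousFun fun x => eval x P := by
  refine ⟨?_, d, hd, hP.eval_smul⟩
  have h := AnalyticOnNhd.aeval_mvPolynomial (𝕜 := ℂ) (s := Set.univ)
    (f := fun x : Fin (N + 1) → ℂ => x)
    (fun i x _ => (ContinuousLinearMap.proj (R := ℂ) (φ := fun _ => ℂ) i).analyticAt x) P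
  exact h

variable {m N : ℕ}

theorem MeromorphicMap.image_subset_of_forall {g : MeromorphicMap m N}
    {Φ : (Fin (N + 1) → ℂ) → ℂ} (hΦ : IsHomogeneousFun Φ)
    (h : ∀ z ψ, g.IsRepAt z ψ → Φ (ψ z) = 0) : g.image ⊆ {x | Φ x.rep = 0} := by
  rintro _ ⟨⟨z, hz⟩, rfl⟩
  obtain ⟨ψ, hψ⟩ := g.exists_isRepAt z
  by_contra h0
  exact (hψ.ne_zero_iff hΦ).2 ⟨hz, h0⟩ (h z ψ hψ)

/-- The image of `g` is not contained in a hypersurface of degree at most `D`. -/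
def NondegenerateUpTo (g : MeromorphicMap m N) (D : ℕ) : Prop :=
  ∀ d ≤ D, ∀ X : Set (ProjSpace N), IsHypersurface d X → ¬ g.image ⊆ X

theorem NondegenerateUpTo.eval_eq_zero {g : MeromorphicMap m N} {D d : ℕ}
    (hg : NondegenerateUpTo g D) (hd : d ≠ 0) (hdD : d ≤ D) {P : MvPolynomial (Fin (N + 1)) ℂ}
    (hP : P.IsHomogeneous d) (h : ∀ z ψ, g.IsRepAt z ψ → eval (ψ z) P = 0) (x : Fin (N + 1) → ℂ) :
    eval x P = 0 := by
  have hP0 : P = 0 := by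
    by_contra hP0
    exact hg d hdD (projZeros P) ⟨Nat.pos_of_ne_zero hd, P, hP0, hP, rfl⟩
      (MeromorphicMap.image_subset_of_forall (hP.isHomogeneousFun hd) h)
  rw [hP0, map_zero]

/-- The linear polynomial of a linear form. -/
noncomputable def formPoly (ℓ : Module.Dual ℂ (Fin (N + 1) → ℂ)) : MvPolynomial (Fin (N + 1)) ℂ :=
  ∑ i, C (ℓ (Pi.single i 1)) * X i

theorem isHomogeneous_formPoly (ℓ : Module.Dual ℂ (Fin (N + 1) → ℂ)) :
    (formPoly ℓ).IsHomogeneous 1 :=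
  IsHomogeneous.sum _ _ _ fun i _ => isHomogeneous_C_mul_X _ i

theorem eval_formPoly (ℓ : Module.Dual ℂ (Fin (N + 1) → ℂ)) (x : Fin (N + 1) → ℂ) :
    eval x (formPoly ℓ) = ℓ x := by
  conv_rhs => rw [pi_eq_sum_univ' x]
  simp [formPoly, map_sum, mul_comm]

theorem NondegenerateUpTo.linear_eq_zero {g : MeromorphicMap m N} {D : ℕ}
    (hg : NondegenerateUpTo g D) (hD : 1 ≤ D) {ℓ : Module.Dual ℂ (Fin (N + 1) → ℂ)}
    (h : ∀ z ψ, g.IsRepAt z ψ → ℓ (ψ z) = 0) : ℓ = 0 := by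
  refine LinearMap.ext fun x => ?_
  rw [← eval_formPoly]
  exact hg.eval_eq_zero one_ne_zero hD (isHomogeneous_formPoly ℓ)
    (fun z ψ hψ => by rw [eval_formPoly]; exact h z ψ hψ) x

/-- Both sides are homogeneous of degree `K.card`. If their difference were a nonzero polynomial, it
would define a forbidden hypersurface containing the image of `g`. -/
theorem NondegenerateUpTo.prod_eq {g : MeromorphicMap m N} {D : ℕ}
    (hg : NondegenerateUpTo g D) {ι : Type*} {K : Finset ι} (hK : K.Nonempty) (hKD : K.card ≤ D)
    {A B : ι → Module.Dual ℂ (Fin (N + 1) → ℂ)} {c : ℂ}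
    (h : ∀ z ψ, g.IsRepAt z ψ → ∏ j ∈ K, A j (ψ z) = c * ∏ j ∈ K, B j (ψ z))
    (x : Fin (N + 1) → ℂ) : ∏ j ∈ K, A j x = c * ∏ j ∈ K, B j x := by
  have hprod : ∀ A : ι → Module.Dual ℂ (Fin (N + 1) → ℂ),
      (∏ j ∈ K, formPoly (A j)).IsHomogeneous K.card := by
    intro A
    have := IsHomogeneous.prod K (fun j => formPoly (A j)) (fun _ => 1)
      fun j _ => isHomogeneous_formPoly (A j)
    simpa using this
  have hev : ∀ x, eval x (∏ j ∈ K, formPoly (A j) - C c * ∏ j ∈ K, formPoly (B j)) =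
      ∏ j ∈ K, A j x - c * ∏ j ∈ K, B j x := by
    intro x
    simp [eval_formPoly]
  rw [← sub_eq_zero, ← hev]
  refine hg.eval_eq_zero (Finset.card_pos.2 hK).ne' hKD
    ((hprod A).sub ((hprod B).C_mul c)) (fun z ψ hψ => ?_) x
  rw [hev, h z ψ hψ, sub_self]

theorem NondegenerateUpTo.mul_eq_mul {g : MeromorphicMap m N} {D : ℕ}
    (hg : NondegenerateUpTo g D) (hD : 2 ≤ D) {P Q P' Q' : Module.Dual ℂ (Fin (N + 1) → ℂ)}
    (h : ∀ z ψ, g.IsRepAt z ψ → P (ψ z) * Q' (ψ z) = P' (ψ z) * Q (ψ z))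
    (x : Fin (N + 1) → ℂ) : P x * Q' x = P' x * Q x := by
  have := hg.prod_eq (K := (Finset.univ : Finset (Fin 2))) Finset.univ_nonempty (by simpa using hD)
    (A := ![P, Q']) (B := ![P', Q]) (c := 1)
    (fun z ψ hψ => by simpa [Fin.prod_univ_two] using h z ψ hψ) x
  simpa [Fin.prod_univ_two] using this

end Nondegenerate

/-! ### Linear factors of products of forms -/

section Forms

variable {V : Type*} [AddCommGroup V] [Module ℂ V]

theorem exists_smul_of_ker_le {ℓ b : Module.Dual ℂ V} (h : ∀ x, b x = 0 → ℓ x = 0) :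
    ∃ c : ℂ, ℓ = c • b := by
  have := mem_span_of_iInf_ker_le_ker (L := fun _ : Unit => b) (K := ℓ) (by
    intro x hx
    rw [Submodule.mem_iInf] at hx
    exact h x (hx ()))
  rw [Set.range_const, Submodule.mem_span_singleton] at this
  obtain ⟨c, hc⟩ := this
  exact ⟨c, hc.symm⟩

/-- If a product of linear forms vanishes on the kernel of a linear form `b`, then one of them is
a multiple of `b`. -/
theorem exists_smul_of_prod_eq_zero {ι : Type*} {K : Finset ι} {A : ι → Module.Dual ℂ V}
    {b : Module.Dual ℂ V} (h : ∀ x, b x = 0 → ∏ j ∈ K, A j x = 0) :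
    ∃ i ∈ K, ∃ c : ℂ, A i = c • b := by
  -- A vector space over an infinite field is not a finite union of proper subspaces, so one of the
  -- forms vanishes on all of `ker b`.
  have hcover : ⋃ i : K, ((LinearMap.ker ((A i).domRestrict (LinearMap.ker b)) :
      Submodule ℂ (LinearMap.ker b)) : Set (LinearMap.ker b)) = Set.univ := by
    rw [Set.eq_univ_iff_forall]
    intro x
    obtain ⟨i, hi, hix⟩ := Finset.prod_eq_zero_iff.1 (h x x.2)
    exact Set.mem_iUnion.2 ⟨⟨i, hi⟩, hix⟩
  obtain ⟨⟨i, hi⟩, htop⟩ := Subspace.exists_eq_top_of_iUnion_eq_univ hcover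
  refine ⟨i, hi, exists_smul_of_ker_le fun x hx => ?_⟩
  have : (⟨x, hx⟩ : LinearMap.ker b) ∈ LinearMap.ker ((A i).domRestrict (LinearMap.ker b)) := by
    rw [htop]; trivial
  exact this

end Forms

/-! ### Consequences of classes of equal weight -/

section Uniqueness

variable {m n N q : ℕ}

theorem InGeneralPosition.exists_eq_sum {H : Fin q → Hyperplane n} (hH : InGeneralPosition H)
    {s : Finset (Fin q)} (hs : s.card = n + 1) (ℓ : Module.Dual ℂ (Fin (n + 1) → ℂ)) :
    ∃ κ : Fin q → ℂ, ∀ x, ℓ x = ∑ j ∈ s, κ j * (H j).rep x := by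
  have hspan : Submodule.span ℂ (Set.range fun i : s => (H i).rep) = ⊤ :=
    (hH.linearIndependent hs.le).span_eq_top_of_card_eq_finrank'
      (by simp [hs, Subspace.dual_finrank_eq])
  have hℓ : ℓ ∈ Submodule.span ℂ (Set.range fun i : s => (H i).rep) := hspan ▸ Submodule.mem_top
  obtain ⟨κ, hκ⟩ := (Submodule.mem_span_range_iff_exists_fun ℂ).1 hℓ
  refine ⟨fun j => if h : j ∈ s then κ ⟨j, h⟩ else 0, fun x => ?_⟩
  rw [← hκ, LinearMap.sum_apply, ← Finset.sum_coe_sort s]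
  refine Finset.sum_congr rfl fun j _ => ?_
  simp only [dif_pos j.2, Subtype.coe_eta]
  rfl

/-- The quotients of two functions of equal weight are constant. -/
theorem const_of_weight_eq {X Γ : Type*} [AddCommGroup Γ] {R : Fin q → X → ℂ} {w : Fin q → Γ}
    (hR0 : ∀ j z, R j z ≠ 0)
    (hw : ∀ a : Fin q → ℤ, ∑ j, a j • w j = 0 ↔ ∃ c : ℂ, ∀ z, ∏ j, R j z ^ a j = c)
    {i j : Fin q} (h : w i = w j) : ∃ c : ℂ, ∀ z, R i z = c * R j z := by
  have h1 := (weights_iff hR0 hw {i} (indicatorExp {j})).1 (by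
    rw [sum_indicatorExp_smul]; simpa using h)
  simpa only [prod_zpow_indicatorExp, Finset.prod_singleton] using h1

theorem IsRatioFamily.forms_eq {f : MeromorphicMap m n} {H : Fin q → Hyperplane n}
    {g : MeromorphicMap m N} {H' : Fin q → Hyperplane N} {R : Fin q → (Fin m → ℂ) → ℂ}
    (hR : IsRatioFamily f H g H' R) {z : Fin m → ℂ} {φ : (Fin m → ℂ) → (Fin (n + 1) → ℂ)}
    {ψ : (Fin m → ℂ) → (Fin (N + 1) → ℂ)} (hφ : f.IsRepAt z φ) (hψ : g.IsRepAt z ψ) :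
    ∃ u : ℂ, u ≠ 0 ∧ ∀ j, (H j).rep (φ z) = u * R j z * (H' j).rep (ψ z) := by
  obtain ⟨u, hu0, -, hu⟩ := hR.eq_mul z φ ψ hφ hψ
  exact ⟨u z, hu0, hu.self_of_nhds⟩

/-- Expanding `H j₀` and `H j₁` in the remaining `n + 1` forms gives `R j₀ P + R j₁ Q = 0` and `R j₀
P' + R j₁ Q' = 0` along `g`, with linear forms `P`, `Q`, `P'`, `Q'`. Hence the quadric `P Q' - P' Q`
vanishes along `g` and so identically. As `n + 3 ≤ N + 1`, some point has `H' j₀ = H' j₁ = 1` and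
all the other forms zero, and there the quadric equals `1`. -/
theorem IsRatioFamily.not_two_classes {f : MeromorphicMap m n} {H : Fin q → Hyperplane n}
    {g : MeromorphicMap m N} {H' : Fin q → Hyperplane N} {R : Fin q → (Fin m → ℂ) → ℂ}
    (hR : IsRatioFamily f H g H' R) (hH : InGeneralPosition H) (hH' : InGeneralPosition H')
    (hN : n + 2 ≤ N) {D : ℕ} (hD : 2 ≤ D) (hg : NondegenerateUpTo g D)
    {X Y : Finset (Fin q)} (hXY : Disjoint X Y) (hcard : X.card + Y.card = n + 3)
    {j₀ j₁ : Fin q} (hj₀ : j₀ ∈ X) (hj₁ : j₁ ∈ Y) {c d : Fin q → ℂ}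
    (hc : ∀ j ∈ X, ∀ z, R j z = c j * R j₀ z) (hd : ∀ j ∈ Y, ∀ z, R j z = d j * R j₁ z) : False := by
  classical
  set S := X.erase j₀ with hS
  set T := Y.erase j₁ with hT
  have hST : Disjoint S T := hXY.mono (Finset.erase_subset _ _) (Finset.erase_subset _ _)
  have hSTc : (S ∪ T).card = n + 1 := by
    rw [Finset.card_union_of_disjoint hST, Finset.card_erase_of_mem hj₀,
      Finset.card_erase_of_mem hj₁]
    have := Finset.card_pos.2 ⟨j₀, hj₀⟩
    have := Finset.card_pos.2 ⟨j₁, hj₁⟩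
    omega
  obtain ⟨κ, hκ⟩ := hH.exists_eq_sum hSTc (H j₀).rep
  obtain ⟨κ', hκ'⟩ := hH.exists_eq_sum hSTc (H j₁).rep
  set P : Module.Dual ℂ (Fin (N + 1) → ℂ) := (H' j₀).rep - ∑ j ∈ S, (κ j * c j) • (H' j).rep with hP
  set Q : Module.Dual ℂ (Fin (N + 1) → ℂ) := -∑ j ∈ T, (κ j * d j) • (H' j).rep with hQ
  set P' : Module.Dual ℂ (Fin (N + 1) → ℂ) := -∑ j ∈ S, (κ' j * c j) • (H' j).rep with hP'
  set Q' : Module.Dual ℂ (Fin (N + 1) → ℂ) := (H' j₁).rep - ∑ j ∈ T, (κ' j * d j) • (H' j).rep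
    with hQ'
  have hzero : ∀ z ψ, g.IsRepAt z ψ → P (ψ z) * Q' (ψ z) = P' (ψ z) * Q (ψ z) := by
    intro z ψ hψ
    obtain ⟨φ, hφ⟩ := f.exists_isRepAt z
    obtain ⟨u, hu0, hu⟩ := hR.forms_eq hφ hψ
    have hsum : ∀ τ : Fin q → ℂ, ∑ j ∈ S ∪ T, τ j * (H j).rep (φ z) =
        u * (R j₀ z * ∑ j ∈ S, (τ j * c j) * (H' j).rep (ψ z) +
          R j₁ z * ∑ j ∈ T, (τ j * d j) * (H' j).rep (ψ z)) := by
      intro τ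
      rw [Finset.sum_union hST, mul_add]
      simp only [Finset.mul_sum]
      congr 1
      · refine Finset.sum_congr rfl fun j hj => ?_
        rw [hu, hc j (Finset.mem_of_mem_erase hj)]; ring
      · refine Finset.sum_congr rfl fun j hj => ?_
        rw [hu, hd j (Finset.mem_of_mem_erase hj)]; ring
    have e1 := hκ (φ z)
    have e2 := hκ' (φ z)
    rw [hsum, hu, mul_assoc] at e1 e2
    have e1' := mul_left_cancel₀ hu0 e1
    have e2' := mul_left_cancel₀ hu0 e2
    simp only [hP, hQ, hP', hQ', LinearMap.sub_apply, LinearMap.neg_apply, LinearMap.sum_apply,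
      LinearMap.smul_apply, smul_eq_mul]
    set p := ∑ j ∈ S, (κ j * c j) * (H' j).rep (ψ z)
    set p' := ∑ j ∈ S, (κ' j * c j) * (H' j).rep (ψ z)
    set r := ∑ j ∈ T, (κ j * d j) * (H' j).rep (ψ z)
    set r' := ∑ j ∈ T, (κ' j * d j) * (H' j).rep (ψ z)
    apply mul_left_cancel₀ (hR.ne_zero j₀ z)
    linear_combination ((H' j₁).rep (ψ z) - r') * e1' + r * e2'
  obtain ⟨x, hx⟩ := hH'.exists_eq (s := X ∪ Y)
    (by rw [Finset.card_union_of_disjoint hXY, hcard]; omega)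
    (fun j => if j = j₀ ∨ j = j₁ then 1 else 0)
  have hxS : ∀ j ∈ S, (H' j).rep x = 0 := by
    intro j hj
    rw [Finset.mem_erase] at hj
    rw [hx j (Finset.mem_union_left _ hj.2), if_neg]
    rintro (h | h)
    · exact hj.1 h
    · exact Finset.disjoint_left.1 hXY hj.2 (h ▸ hj₁)
  have hxT : ∀ j ∈ T, (H' j).rep x = 0 := by
    intro j hj
    rw [Finset.mem_erase] at hj
    rw [hx j (Finset.mem_union_right _ hj.2), if_neg]
    rintro (h | h)
    · exact Finset.disjoint_left.1 hXY hj₀ (h ▸ hj.2)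
    · exact hj.1 h
  have h0 : (H' j₀).rep x = 1 := by rw [hx j₀ (Finset.mem_union_left _ hj₀), if_pos (Or.inl rfl)]
  have h1 : (H' j₁).rep x = 1 := by rw [hx j₁ (Finset.mem_union_right _ hj₁), if_pos (Or.inr rfl)]
  have hfin := hg.mul_eq_mul hD hzero x
  have s1 : ∀ τ : Fin q → ℂ, ∑ j ∈ S, τ j * (H' j).rep x = 0 := fun τ =>
    Finset.sum_eq_zero fun j hj => by rw [hxS j hj, mul_zero]
  have s2 : ∀ τ : Fin q → ℂ, ∑ j ∈ T, τ j * (H' j).rep x = 0 := fun τ =>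
    Finset.sum_eq_zero fun j hj => by rw [hxT j hj, mul_zero]
  simp only [hP, hQ, hP', hQ', LinearMap.sub_apply, LinearMap.neg_apply, LinearMap.sum_apply,
      LinearMap.smul_apply, smul_eq_mul, s1, s2, h0, h1] at hfin
  norm_num at hfin

/-- If `n + 1` of the quotients are proportional, then `f` is a linear image of `g`. -/
theorem IsRatioFamily.exists_linearMap {f : MeromorphicMap m n} {H : Fin q → Hyperplane n}
    {g : MeromorphicMap m N} {H' : Fin q → Hyperplane N} {R : Fin q → (Fin m → ℂ) → ℂ}
    (hR : IsRatioFamily f H g H' R) (hH : InGeneralPosition H)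
    {E : Finset (Fin q)} (hE : E.card = n + 1) {i₀ : Fin q} {c : Fin q → ℂ}
    (hc : ∀ j ∈ E, ∀ z, R j z = c j * R i₀ z) :
    ∃ M : (Fin (N + 1) → ℂ) →ₗ[ℂ] (Fin (n + 1) → ℂ),
      (∀ j ∈ E, (H j).rep ∘ₗ M = c j • (H' j).rep) ∧
      ∀ z φ ψ, f.IsRepAt z φ → g.IsRepAt z ψ → ∃ v : ℂ, v ≠ 0 ∧ φ z = v • M (ψ z) ∧
        ∀ j, R i₀ z * (H j).rep (M (ψ z)) = R j z * (H' j).rep (ψ z) := by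
  set Φ : (Fin (n + 1) → ℂ) →ₗ[ℂ] (E → ℂ) := LinearMap.pi fun i => (H i).rep with hΦ
  have hbij : Function.Bijective Φ := by
    constructor
    · rw [injective_iff_map_eq_zero]
      intro x hx
      exact hH.eq_zero hE fun j hj => congrFun hx ⟨j, hj⟩
    · intro y
      obtain ⟨x, hx⟩ := hH.exists_eq hE.le fun j => if h : j ∈ E then y ⟨j, h⟩ else 0
      refine ⟨x, funext fun j => ?_⟩
      have := hx j j.2
      rw [dif_pos j.2] at this
      exact this
  set e := LinearEquiv.ofBijective Φ hbij with he
  -- The forms `H j`, `j ∈ E`, are coordinates on `ℂⁿ⁺¹`; the map sought has coordinates `c j • H'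
  -- j`.
  set B : (Fin (N + 1) → ℂ) →ₗ[ℂ] (E → ℂ) := LinearMap.pi fun i => c i • (H' i).rep with hB
  have hM : ∀ j ∈ E, ∀ y, (H j).rep (e.symm (B y)) = c j * (H' j).rep y := by
    intro j hj y
    exact congrFun (e.apply_symm_apply (B y)) ⟨j, hj⟩
  refine ⟨e.symm.toLinearMap ∘ₗ B, fun j hj => LinearMap.ext fun y => hM j hj y, ?_⟩
  intro z φ ψ hφ hψ
  obtain ⟨u, hu0, hu⟩ := hR.forms_eq hφ hψ
  have hv0 := mul_ne_zero hu0 (hR.ne_zero i₀ z)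
  have heq : φ z = (u * R i₀ z) • e.symm (B (ψ z)) := by
    rw [← sub_eq_zero]
    apply hH.eq_zero hE
    intro j hj
    rw [map_sub, map_smul, hM j hj, hu, hc j hj, smul_eq_mul]
    ring
  refine ⟨u * R i₀ z, hv0, heq, fun j => ?_⟩
  apply mul_left_cancel₀ hu0
  have h1 := hu j
  rw [heq, map_smul, smul_eq_mul] at h1
  simp only [LinearMap.comp_apply, LinearEquiv.coe_coe]
  linear_combination h1

end Uniqueness

/-! ### Matching hyperplanes and identifying the maps -/

section Conclusion

variable {m n N q : ℕ}

/-- `H i` is a combination of the `H j`, `j ∈ E`, so `H' t` is a combination of the `H' j`, `j ∈ E`.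
For `n < N` these `n + 2` forms would be independent. -/
theorem InGeneralPosition.le_of_comp_eq_smul {H : Fin q → Hyperplane n}
    {H' : Fin q → Hyperplane N} (hH : InGeneralPosition H) (hH' : InGeneralPosition H')
    {E : Finset (Fin q)} (hE : E.card = n + 1) {c : Fin q → ℂ}
    {M : (Fin (N + 1) → ℂ) →ₗ[ℂ] (Fin (n + 1) → ℂ)}
    (hM : ∀ j ∈ E, (H j).rep ∘ₗ M = c j • (H' j).rep) {i t : Fin q} (ht : t ∉ E) {a : ℂ}
    (ha : a ≠ 0) (hi : (H i).rep ∘ₗ M = a • (H' t).rep) : N ≤ n := by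
  classical
  by_contra! hN
  obtain ⟨κ, hκ⟩ := hH.exists_eq_sum hE (H i).rep
  obtain ⟨x, hx⟩ := hH'.exists_eq (s := insert t E)
    (by rw [Finset.card_insert_of_notMem ht, hE]; omega) (fun j => if j = t then 1 else 0)
  have h1 : (H i).rep (M x) = 0 := by
    rw [hκ]
    refine Finset.sum_eq_zero fun j hj => ?_
    have h2 := LinearMap.congr_fun (hM j hj) x
    rw [LinearMap.comp_apply, LinearMap.smul_apply, hx j (Finset.mem_insert_of_mem hj),
      if_neg (fun h : j = t => ht (h ▸ hj)), smul_zero] at h2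
    rw [h2, mul_zero]
  have h2 := LinearMap.congr_fun hi x
  rw [LinearMap.comp_apply, h1, LinearMap.smul_apply, hx t (Finset.mem_insert_self _ _), if_pos rfl,
    smul_eq_mul, mul_one] at h2
  exact ha h2.symm

/-- A heavy class of weights gives a linear map `M` relating `f` to `g`,
which matches
`n + 1` of the hyperplanes with their namesakes, and either one more hyperplane with
its namesake or two more hyperplanes crosswise. -/
theorem IsRatioFamily.exists_matching {f : MeromorphicMap m n} {H : Fin q → Hyperplane n}
    {g : MeromorphicMap m N} {H' : Fin q → Hyperplane N} {R : Fin q → (Fin m → ℂ) → ℂ}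
    (hR : IsRatioFamily f H g H' R) (hn : 1 ≤ n) (hnN : n ≤ N)
    (hH : InGeneralPosition H) (hH' : InGeneralPosition H')
    (hg : NondegenerateUpTo g (min (n + 1) (N - n + 2))) {Γ : Type*} [AddCommGroup Γ]
    {w : Fin q → Γ}
    (hw : ∀ a : Fin q → ℤ, ∑ j, a j • w j = 0 ↔ ∃ c : ℂ, ∀ z, ∏ j, R j z ^ a j = c)
    (hheavy : HasHeavyClass n N w) :
    N = n ∧ ∃ (M : (Fin (N + 1) → ℂ) →ₗ[ℂ] (Fin (n + 1) → ℂ)) (E : Finset (Fin q)) (c : Fin q → ℂ),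
      E.card = n + 1 ∧ (∀ j ∈ E, c j ≠ 0 ∧ (H j).rep ∘ₗ M = c j • (H' j).rep) ∧
      (∀ z φ ψ, f.IsRepAt z φ → g.IsRepAt z ψ → ∃ v : ℂ, v ≠ 0 ∧ φ z = v • M (ψ z)) ∧
      ((∃ t ∉ E, ∃ a : ℂ, a ≠ 0 ∧ (H t).rep ∘ₗ M = a • (H' t).rep) ∨
        ∃ s ∉ E, ∃ t ∉ E, s ≠ t ∧ ∃ a b : ℂ, a ≠ 0 ∧ b ≠ 0 ∧
          (H t).rep ∘ₗ M = a • (H' s).rep ∧ (H s).rep ∘ₗ M = b • (H' t).rep) := by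
  classical
  have hD : 2 ≤ min (n + 1) (N - n + 2) := by omega
  have hR0 := hR.ne_zero
  obtain ⟨E, e, hE, hEe, hcases⟩ := hheavy
  obtain ⟨i₀, hi₀⟩ : E.Nonempty := Finset.card_pos.1 (by omega)
  have hcon : ∀ j, w j = e → ∃ c : ℂ, ∀ z, R j z = c * R i₀ z := fun j hj =>
    const_of_weight_eq hR0 hw (hj.trans (hEe i₀ hi₀).symm)
  have : ∀ j, ∃ c : ℂ, j ∈ E → ∀ z, R j z = c * R i₀ z := by
    intro j
    by_cases hj : j ∈ E
    · obtain ⟨c, hc⟩ := hcon j (hEe j hj)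
      exact ⟨c, fun _ => hc⟩
    · exact ⟨0, fun h => absurd h hj⟩
  choose c hc using this
  obtain ⟨M, hM, hfg⟩ := hR.exists_linearMap hH hE hc
  have hgen : ∀ z ψ, g.IsRepAt z ψ → ∀ j,
      R i₀ z * (H j).rep (M (ψ z)) = R j z * (H' j).rep (ψ z) := by
    intro z ψ hψ
    obtain ⟨φ, hφ⟩ := f.exists_isRepAt z
    obtain ⟨v, -, -, h⟩ := hfg z φ ψ hφ hψ
    exact h
  -- Otherwise `H' t` would vanish along `g`, which lies in no hyperplane.
  have hA0 : ∀ t, (H t).rep ∘ₗ M ≠ 0 := by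
    intro t h0
    apply Projectivization.rep_nonzero (H' t)
    refine hg.linear_eq_zero (by omega) fun z ψ hψ => ?_
    have h1 := hgen z ψ hψ t
    rw [← LinearMap.comp_apply, h0, LinearMap.zero_apply, mul_zero] at h1
    exact (mul_eq_zero.1 h1.symm).resolve_left (hR0 t z)
  have hsmul0 : ∀ {t : Fin q} {a : ℂ} {b : Module.Dual ℂ (Fin (N + 1) → ℂ)},
      (H t).rep ∘ₗ M = a • b → a ≠ 0 := by
    rintro t a b h rfl
    exact hA0 t (by rw [h, zero_smul])
  have hle : ∀ {i t : Fin q} {a : ℂ}, t ∉ E → (H i).rep ∘ₗ M = a • (H' t).rep → N = n :=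
    fun ht h => le_antisymm (hH.le_of_comp_eq_smul hH' hE hM ht (hsmul0 h) h) hnN
  have hfin : ((∃ t ∉ E, ∃ a : ℂ, (H t).rep ∘ₗ M = a • (H' t).rep) ∨
        ∃ s ∉ E, ∃ t ∉ E, s ≠ t ∧ ∃ a b : ℂ,
          (H t).rep ∘ₗ M = a • (H' s).rep ∧ (H s).rep ∘ₗ M = b • (H' t).rep) := by
    rcases hcases with ⟨t, ht, hte⟩ | ⟨s, hs, t, ht, hst, hwst⟩ | ⟨K, hKE, hK0, hK1, hK2, hKe⟩
    · left
      obtain ⟨a, ha⟩ := hcon t hte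
      refine ⟨t, ht, a, ?_⟩
      rw [← sub_eq_zero]
      refine hg.linear_eq_zero (by omega) fun z ψ hψ => ?_
      have h1 := hgen z ψ hψ t
      rw [ha] at h1
      apply mul_left_cancel₀ (hR0 i₀ z)
      simp only [LinearMap.sub_apply, LinearMap.comp_apply, LinearMap.smul_apply, smul_eq_mul]
      linear_combination h1
    · left
      obtain ⟨a, ha⟩ := const_of_weight_eq hR0 hw hwst
      have h1 : ∀ z ψ, g.IsRepAt z ψ → ((H s).rep ∘ₗ M) (ψ z) * (H' t).rep (ψ z) =
          (a • ((H t).rep ∘ₗ M)) (ψ z) * (H' s).rep (ψ z) := by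
        intro z ψ hψ
        have h1 := hgen z ψ hψ s
        have h2 := hgen z ψ hψ t
        rw [ha] at h1
        apply mul_left_cancel₀ (hR0 i₀ z)
        simp only [LinearMap.comp_apply, LinearMap.smul_apply, smul_eq_mul]
        linear_combination (H' t).rep (ψ z) * h1 - a * (H' s).rep (ψ z) * h2
      have ha0 : a ≠ 0 := by
        rintro rfl
        exact hR0 s 0 (by rw [ha, zero_mul])
      -- The quadratic identity shows that `(H t ∘ M) * H' s` vanishes on the kernel of `H' t`. By
      -- general position `H' s` is not a multiple of `H' t`, so `H t ∘ M` is.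
      have h2 := hg.mul_eq_mul hD h1
      obtain ⟨i, -, b, hb⟩ := exists_smul_of_prod_eq_zero (K := (Finset.univ : Finset (Fin 2)))
        (A := ![(H t).rep ∘ₗ M, (H' s).rep]) (b := (H' t).rep) (by
          intro x hx
          have h3 := h2 x
          rw [hx, mul_zero, LinearMap.smul_apply, smul_eq_mul, mul_assoc] at h3
          simpa [Fin.prod_univ_two, ha0] using h3.symm)
      fin_cases i
      · exact ⟨t, ht, b, hb⟩
      · exfalso
        obtain ⟨x, hx⟩ := hH'.exists_eq (s := {s, t})
          (by rw [Finset.card_pair hst]; omega) (fun j => if j = s then 1 else 0)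
        have hxs := hx s (by simp)
        have hxt := hx t (by simp)
        rw [if_pos rfl] at hxs
        rw [if_neg hst.symm] at hxt
        have h3 := LinearMap.congr_fun hb x
        change (H' s).rep x = b * (H' t).rep x at h3
        rw [hxs, hxt, mul_zero] at h3
        exact one_ne_zero h3
    · obtain ⟨a, ha⟩ := (weights_iff hR0 hw K ((K.card : ℤ) • indicatorExp {i₀})).1 (by
        simp only [Pi.smul_apply, smul_assoc, ← Finset.smul_sum, sum_indicatorExp_smul,
          Finset.sum_singleton]
        rw [hKe, hEe i₀ hi₀, natCast_zsmul])
      have ha' : ∀ z, ∏ j ∈ K, R j z = a * R i₀ z ^ K.card := by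
        intro z
        rw [ha]
        simp only [Pi.smul_apply, smul_eq_mul, zpow_mul', zpow_natCast]
        rw [Finset.prod_pow, prod_zpow_indicatorExp, Finset.prod_singleton]
      -- The product of the forms `H j ∘ M` over `K` is a constant times that of the `H' j`, so each
      -- `H' j` is proportional to some `H i ∘ M`. One such match already forces `N = n`, whence `K`
      -- has at most `N - n + 2 = 2` elements.
      have h1 := hg.prod_eq hK0 (by omega) (A := fun j => (H j).rep ∘ₗ M)
        (B := fun j => (H' j).rep) (c := a) (by
          intro z ψ hψ
          simp only [LinearMap.comp_apply]
          apply mul_left_cancel₀ (pow_ne_zero K.card (hR0 i₀ z))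
          rw [← Finset.prod_const, ← Finset.prod_mul_distrib,
            Finset.prod_congr rfl fun j _ => hgen z ψ hψ j, Finset.prod_mul_distrib, ha',
            Finset.prod_const]
          ring)
      have h2 : ∀ j ∈ K, ∃ i ∈ K, ∃ b : ℂ, (H i).rep ∘ₗ M = b • (H' j).rep := fun j hj =>
        exists_smul_of_prod_eq_zero fun x hx => by
          rw [h1, Finset.prod_eq_zero hj hx, mul_zero]
      have hKn : ∀ j ∈ K, j ∉ E := fun j hj => Finset.disjoint_left.1 hKE hj
      obtain ⟨j₀, hj₀⟩ := hK0
      obtain ⟨i, -, b, hb⟩ := h2 j₀ hj₀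
      have hNn := hle (hKn j₀ hj₀) hb
      have hKc := Finset.card_pos.2 ⟨j₀, hj₀⟩
      obtain hK | hK : K.card = 1 ∨ K.card = 2 := by omega
      · obtain ⟨s, rfl⟩ := Finset.card_eq_one.1 hK
        obtain ⟨i, hi, b, hb⟩ := h2 s (by simp)
        obtain rfl := Finset.mem_singleton.1 hi
        exact Or.inl ⟨i, hKn i (by simp), b, hb⟩
      · obtain ⟨s, t, hst, rfl⟩ := Finset.card_eq_two.1 hK
        have hs := hKn s (by simp)
        have ht := hKn t (by simp)
        obtain ⟨i, hi, d, hd⟩ := h2 s (by simp)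
        obtain ⟨j, hj, b, hb⟩ := h2 t (by simp)
        simp only [Finset.mem_insert, Finset.mem_singleton] at hi hj
        rcases hi with rfl | rfl
        · exact Or.inl ⟨i, hs, d, hd⟩
        · rcases hj with rfl | rfl
          · exact Or.inr ⟨j, hs, i, ht, hst, d, b, hd, hb⟩
          · exact Or.inl ⟨j, ht, b, hb⟩
  have hM' : ∀ j ∈ E, c j ≠ 0 ∧ (H j).rep ∘ₗ M = c j • (H' j).rep := fun j hj =>
    ⟨hsmul0 (hM j hj), hM j hj⟩
  have hfg' : ∀ z φ ψ, f.IsRepAt z φ → g.IsRepAt z ψ → ∃ v : ℂ, v ≠ 0 ∧ φ z = v • M (ψ z) :=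
    fun z φ ψ hφ hψ => by
      obtain ⟨v, hv, h, -⟩ := hfg z φ ψ hφ hψ
      exact ⟨v, hv, h⟩
  rcases hfin with ⟨t, ht, a, h⟩ | ⟨s, hs, t, ht, hst, a, b, h, h'⟩
  · exact ⟨hle ht h, M, E, c, hE, hM', hfg', Or.inl ⟨t, ht, a, hsmul0 h, h⟩⟩
  · exact ⟨hle hs h, M, E, c, hE, hM', hfg',
      Or.inr ⟨s, hs, t, ht, hst, a, b, hsmul0 h, hsmul0 h', h, h'⟩⟩

theorem Hyperplane.mk_mem_carrier {H : Hyperplane n} {v : Fin (n + 1) → ℂ} (hv : v ≠ 0) :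
    Projectivization.mk ℂ v hv ∈ H.carrier ↔ H.rep v = 0 := by
  obtain ⟨a, ha⟩ := Projectivization.exists_smul_eq_mk_rep ℂ v hv
  change H.rep (Projectivization.mk ℂ v hv).rep = 0 ↔ _
  rw [← ha, Units.smul_def, map_smul, smul_eq_mul, mul_eq_zero, or_iff_right a.ne_zero]

theorem projLinear_image_carrier {L : (Fin (N + 1) → ℂ) ≃ₗ[ℂ] (Fin (n + 1) → ℂ)}
    {H : Hyperplane n} {H' : Hyperplane N} {a : ℂ} (ha : a ≠ 0)
    (h : H.rep ∘ₗ L.toLinearMap = a • H'.rep) : projLinear L '' H'.carrier = H.carrier := by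
  have hL : ∀ x, H.rep (L x) = a * H'.rep x := fun x => LinearMap.congr_fun h x
  have hmem : ∀ x, projLinear L x ∈ H.carrier ↔ x ∈ H'.carrier := by
    intro x
    induction x using Projectivization.ind with
    | h v hv =>
      rw [Hyperplane.mk_mem_carrier]
      change Projectivization.mk ℂ (L v) _ ∈ H.carrier ↔ _
      rw [Hyperplane.mk_mem_carrier, hL, mul_eq_zero, or_iff_right ha]
  ext y
  constructor
  · rintro ⟨x, hx, rfl⟩
    exact (hmem x).2 hx
  · intro hy
    obtain ⟨x, rfl⟩ : ∃ x, projLinear L x = y := by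
      induction y using Projectivization.ind with
      | h v hv =>
        refine ⟨Projectivization.mk ℂ (L.symm v) (by simpa using hv), ?_⟩
        change Projectivization.mk ℂ (L (L.symm v)) _ = _
        simp only [LinearEquiv.apply_symm_apply]
    exact ⟨x, (hmem x).1 hy, rfl⟩

theorem MeromorphicMap.ext_of_forall {f f' : MeromorphicMap m n} (hI : f.indet = f'.indet)
    (h : ∀ z (hz : z ∈ f.indetᶜ) (hz' : z ∈ f'.indetᶜ), f.toFun ⟨z, hz⟩ = f'.toFun ⟨z, hz'⟩) :
    f = f' := by
  obtain ⟨I, F, _, _⟩ := f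
  obtain ⟨I', F', _, _⟩ := f'
  obtain rfl : I = I' := hI
  obtain rfl : F = F' := funext fun z => h z.1 z.2 z.2
  rfl

theorem MeromorphicMap.eq_linearImage {f : MeromorphicMap m n} {g : MeromorphicMap m N}
    {L : (Fin (N + 1) → ℂ) ≃ₗ[ℂ] (Fin (n + 1) → ℂ)}
    (h : ∀ z φ ψ, f.IsRepAt z φ → g.IsRepAt z ψ → ∃ v : ℂ, v ≠ 0 ∧ φ z = v • L (ψ z)) :
    f = MeromorphicMap.linearImage L g := by
  refine MeromorphicMap.ext_of_forall (Set.ext fun z => ?_) fun z hz hz' => ?_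
  all_goals
    obtain ⟨φ, hφ⟩ := f.exists_isRepAt z
    obtain ⟨ψ, hψ⟩ := g.exists_isRepAt z
    obtain ⟨v, hv, hvφ⟩ := h z φ ψ hφ hψ
    obtain ⟨U, -, hzU, hφ⟩ := hφ
    obtain ⟨V, -, hzV, hψ⟩ := hψ
  · change z ∈ f.indet ↔ z ∈ g.indet
    rw [← hφ.zero_iff z hzU, ← hψ.zero_iff z hzV, hvφ, smul_eq_zero, or_iff_right hv]
    exact L.map_eq_zero_iff
  · have hφ0 : φ z ≠ 0 := fun h0 => hz ((hφ.zero_iff z hzU).1 h0)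
    have hψ0 : ψ z ≠ 0 := fun h0 => hz' ((hψ.zero_iff z hzV).1 h0)
    change f.toFun ⟨z, hz⟩ = projLinear L (g.toFun ⟨z, hz'⟩)
    rw [hφ.eq_mk z hzU hz hφ0, hψ.eq_mk z hzV hz' hψ0]
    exact (Projectivization.mk_eq_mk_iff' ℂ _ _ _ (by simpa using hψ0)).2 ⟨v, hvφ.symm⟩

end Conclusion

/-! ### The uniqueness theorem -/

theorem mainTheorem2 (m n N q : ℕ) (hn : 1 ≤ n) (hnN : n ≤ N)
    (H : Fin q → Hyperplane n) (H' : Fin q → Hyperplane N)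
    (hH : InGeneralPosition H) (hH' : InGeneralPosition H')
    (f : MeromorphicMap m n) (g : MeromorphicMap m N)
    (hf : ∀ j, ¬ f.image ⊆ (H j).carrier)
    (hg : ∀ j, ¬ g.image ⊆ (H' j).carrier)
    (hfg : ∀ j, f.SamePullbackDivisor (H j) g (H' j))
    (hgdeg : ∀ d ≤ min (n + 1) (N - n + 2), ∀ X : Set (ProjSpace N),
      IsHypersurface d X → ¬ g.image ⊆ X)
    (hq : (q : ℝ) ≥ max (3 * (n : ℝ) + 1)
      (min (2 * (N : ℝ) + 1) ((N : ℝ) + 3 / 2 * (n : ℝ) + 3 / 2))) :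
    N = n ∧
      ∃ L : (Fin (N + 1) → ℂ) ≃ₗ[ℂ] (Fin (n + 1) → ℂ),
        f = MeromorphicMap.linearImage L g ∧
        ((∃ k : Fin (n + 2) → Fin q, Function.Injective k ∧
            ∀ i, projLinear L '' (H' (k i)).carrier = (H (k i)).carrier) ∨
          (∃ (k : Fin (n + 1) → Fin q) (s t : Fin q), Function.Injective k ∧
            s ∉ Set.range k ∧ t ∉ Set.range k ∧ s ≠ t ∧
            (∀ i, projLinear L '' (H' (k i)).carrier = (H (k i)).carrier) ∧
            projLinear L '' (H' s).carrier = (H t).carrier ∧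
            projLinear L '' (H' t).carrier = (H s).carrier)) := by
  have hq' : 3 * n + 1 ≤ q ∧ (2 * N + 1 ≤ q ∨ 2 * N + 3 * n + 3 ≤ 2 * q) := by
    rw [ge_iff_le, max_le_iff, min_le_iff] at hq
    obtain ⟨h1, h2⟩ := hq
    refine ⟨by exact_mod_cast h1, h2.imp (fun h => by exact_mod_cast h) fun h => ?_⟩
    have : 2 * (N : ℝ) + 3 * n + 3 ≤ 2 * q := by linarith
    exact_mod_cast this
  obtain ⟨hq1, hq2⟩ := hq'
  obtain ⟨R, hR⟩ := exists_ratioFamily hg hfg ⟨0, by omega⟩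
  obtain ⟨ρ, w, hw⟩ := exists_weights
    (fun j => continuousOn_univ.1 (hR.analytic j).continuousOn) hR.ne_zero
  have hex : ExchangeProperty n N w := by
    intro J hJ I hI hIc
    obtain ⟨I', h1, h2, h3, h4⟩ := hR.exists_exchange hH hH' hg hJ hI hIc
    refine ⟨I', h1, h2, h3, ?_⟩
    rw [← sum_indicatorExp_smul I', eq_comm, weights_iff hR.ne_zero hw]
    simpa only [prod_zpow_indicatorExp] using h4
  have hdeg : NondegenerateUpTo g (min (n + 1) (N - n + 2)) := hgdeg
  rcases hex.heavy_or_two hn hnN hq1 hq2 with hheavy | ⟨hN, X, Y, hXY, hX, hY, hcard, hc, hd⟩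
  · obtain ⟨rfl, M, E, c, hE, hM, hfM, hfin⟩ := hR.exists_matching hn hnN hH hH' hdeg hw hheavy
    -- A vector killed by `M` is annihilated by the `n + 1` forms `H' j`, `j ∈ E`, which have no
    -- common zero but the origin now that `N = n`.
    have hMinj : Function.Injective M := by
      rw [injective_iff_map_eq_zero]
      intro x hx
      refine hH'.eq_zero hE fun j hj => ?_
      have h1 := LinearMap.congr_fun (hM j hj).2 x
      rw [LinearMap.comp_apply, hx, map_zero, LinearMap.smul_apply, smul_eq_mul] at h1
      exact (mul_eq_zero.1 h1.symm).resolve_left (hM j hj).1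
    have himage : ∀ {s t : Fin q} {a : ℂ}, a ≠ 0 → (H t).rep ∘ₗ M = a • (H' s).rep →
        projLinear (LinearEquiv.ofInjectiveEndo M hMinj) '' (H' s).carrier = (H t).carrier :=
      fun ha h => projLinear_image_carrier ha h
    refine ⟨rfl, LinearEquiv.ofInjectiveEndo M hMinj, MeromorphicMap.eq_linearImage hfM, ?_⟩
    rcases hfin with ⟨t, ht, a, ha, h⟩ | ⟨s, hs, t, ht, hst, a, b, ha, hb, h, h'⟩
    · left
      have hcardt : (insert t E).card = N + 2 := by rw [Finset.card_insert_of_notMem ht, hE]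
      refine ⟨(insert t E).orderEmbOfFin hcardt, RelEmbedding.injective _, fun i => ?_⟩
      rcases Finset.mem_insert.1 ((insert t E).orderEmbOfFin_mem hcardt i) with hi | hi
      · rw [hi]
        exact himage ha h
      · exact himage (hM _ hi).1 (hM _ hi).2
    · right
      have hnot : ∀ {j}, j ∉ E → j ∉ Set.range (E.orderEmbOfFin hE) := fun hj => by
        rwa [Finset.range_orderEmbOfFin]
      refine ⟨E.orderEmbOfFin hE, s, t, RelEmbedding.injective _, hnot hs, hnot ht, hst,
        fun i => ?_, himage ha h, himage hb h'⟩
      have hi := E.orderEmbOfFin_mem hE i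
      exact himage (hM _ hi).1 (hM _ hi).2
  · exfalso
    obtain ⟨j₀, hj₀⟩ := hX
    obtain ⟨j₁, hj₁⟩ := hY
    obtain ⟨c, hc⟩ := hc
    obtain ⟨d, hd⟩ := hd
    have hconst : ∀ (Z : Finset (Fin q)) (i : Fin q), (∀ j ∈ Z, w j = w i) →
        ∃ κ : Fin q → ℂ, ∀ j ∈ Z, ∀ z, R j z = κ j * R i z := by
      intro Z i h
      choose κ hκ using fun j : Z => const_of_weight_eq hR.ne_zero hw (h j j.2)
      refine ⟨fun j => if hj : j ∈ Z then κ ⟨j, hj⟩ else 0, fun j hj z => ?_⟩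
      simp only [dif_pos hj]
      exact hκ ⟨j, hj⟩ z
    obtain ⟨κ, hκ⟩ := hconst X j₀ fun j hj => (hc j hj).trans (hc j₀ hj₀).symm
    obtain ⟨τ, hτ⟩ := hconst Y j₁ fun j hj => (hd j hj).trans (hd j₁ hj₁).symm
    exact hR.not_two_classes hH hH' hN (by omega) hdeg hXY hcard hj₀ hj₁ hκ hτ
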